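/- Notation. For an open set $\Omega\subset\mathbb{R}^{2}$ let $\sigma=\mathcal H^1|_{\partial\Omega}$, $\Delta(x,r)=B(x,r)\cap\partial\Omega$ for $x\in\partial\Omega$, $r>0$, and $\delta(X)=\operatorname{dist}(X,\partial\Omega)$. * A closed set $E\subset\mathbb R^2$ is $1$-ADR if there is $D\ge 1$ with $r/D\le\mathcal H^1(B(x,r)\cap E)\le Dr$ for all $x\in E$ and $0<r<\operatorname{diam}E$. * A set $S$ satisfies the corkscrew condition if there is $c>0$ such that for all $x\in\partial S$ and $0<r<\operatorname{diam}\partial S$ there is $Y\in S$ with $B(Y,cr)\subset B(x,r)\cap S$. An open set $\Omega$ satisfies the $2$-sided version of a condition if $\Omega$ and $\operatorname{int}\Omega^c$ both satisfy it. * $\Omega$ satisfies the Harnack chain condition if there are a constant $C\ge1$ and numbers $M(\Lambda)$ such that for all $\rho>0$, $\Lambda\ge1$ and $X,X'\in\Omega$ with $\delta(X),\delta(X')\ge\rho$ and $|X-X'|<\Lambda\rho$ there are open balls $B_1,\dots,B_N\subset\Omega$, $N\le M(\Lambda)$, with $X\in B_1$, $X'\in B_N$, $B_k\cap B_{k+1}\ne\emptyset$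 and $C^{-1}\operatorname{diam}B_k\le\operatorname{dist}(B_k,\partial\Omega)\le C\operatorname{diam}B_k$. (For non-empty boundary this forces $\Omega$ to be connected.) * An open set $\Omega$ is a chord-arc domain if it satisfies the Harnack chain condition, both $\Omega$ and $\mathbb R^2\setminus\Omega$ satisfy the corkscrew condition, and $\partial\Omega$ is $1$-ADR. * A Borel function $\rho:\partial\Omega\to[0,\infty]$ is an upper gradient of $f:\partial\Omega\to\mathbb R$ if $|f(x)-f(y)|\le\int_\gamma\rho$ (arc-length integral) for all $x,y\in\partial\Omega$ and every rectifiable path $\gamma$ in $\partial\Omega$ from $x$ to $y$. $\partial\Omega$ supports a weak $1$-Poincaré inequality if there are $C,\Lambda\ge1$ such that for every $y\in\partial\Omega$, $r>0$, every $f\in L^1_{\mathrm{loc}}(\sigma)$ and every upper gradient $\rho$ of $f$, with $\Delta=\Delta(y,r)$, $\Lambda\Delta=\Delta(y,\Lambda r)$ and $\langle f\rangle_\Delta$ the $\sigma$-average of $f$ over $\Delta$, $$\frac1{\sigma(\Delta)}\int_\Delta|f-\langle f\rangle_\Delta|\,d\sigma\le Cr\,\frac1{\sigma(\Lambda\Delta)}\int_{\Lambda\Delta}\rho\,d\sigma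 .$$ The twice-pinched annulus. Take the two circles $|p|=3$ and $|p|=4$ in $\mathbb R^2$ and remove the points of the strip $-1<y<1$. Join the ends of the remaining four arcs by the line segments from $(\sqrt8,1)$ to $(\sqrt{15},-1)$, from $(\sqrt{15},1)$ to $(\sqrt8,-1)$, and by their reflections in the $y$-axis; let $\Gamma$ be the resulting closed set. Let $\Omega$ be the open region enclosed between the inner and the outer part of $\Gamma$: $$\Omega=\{|y|\ge1,\ 3<|(x,y)|<4\}\cup\Big\{|y|<1,\ \Big||x|-\tfrac{\sqrt{15}+\sqrt8}2\Big|<\tfrac{\sqrt{15}-\sqrt8}2|y|\Big\}.$$ Claim. $\Omega$ is open and bounded, $\partial\Omega=\Gamma$, $\Omega$ is not connected, and $\partial\Omega$ is connected. Moreover $\partial\Omega$ is $1$-ADR, $\Omega$ satisfies the $2$-sided corkscrew condition, and $\partial\Omega$ supports a weak $1$-Poincaré inequality, but $\Omega$ is not a chord-arc domain. Consequently the implication "$U$ is a $2$-sided chord-arc domain $\Rightarrow$ $\partial U$ supports a weak $1$-Poincaré inequality" cannot be reversed: it is not true that every open $U\subset\mathbb R^2$ with non-empty $1$-ADR boundary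 that satisfies the $2$-sided corkscrew condition and whose boundary supports a weak $1$-Poincaré inequality is a $2$-sided chord-arc domain. -/

import Mathlib

open Set MeasureTheory Metric
open scoped ENNReal

noncomputable section

/-! ### Ahlfors--David regularity, corkscrews, Harnack chains, chord-arc domains -/

/-- A closed set `E` is `d`-Ahlfors--David regular: `r ^ d / D ≤ H^d (B(x,r) ∩ E) ≤ D r ^ d` for all
`x ∈ E` and `0 < r < diam E`, where the diameter may be infinite. -/
def IsADR {X : Type*} [MetricSpace X] [MeasurableSpace X] [BorelSpace X]
    (d : ℕ) (E : Set X) : Prop :=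
  IsClosed E ∧ ∃ D : ℝ, 1 ≤ D ∧ ∀ x ∈ E, ∀ r : ℝ, 0 < r → ENNReal.ofReal r < ediam E →
    ENNReal.ofReal (r ^ d / D) ≤ μH[(d : ℝ)] (ball x r ∩ E) ∧
      μH[(d : ℝ)] (ball x r ∩ E) ≤ ENNReal.ofReal (D * r ^ d)

/-- The corkscrew condition for a set `S`. -/
def Corkscrew {X : Type*} [MetricSpace X] (S : Set X) : Prop :=
  ∃ c : ℝ, 0 < c ∧ ∀ x ∈ frontier S, ∀ r : ℝ, 0 < r → ENNReal.ofReal r < ediam (frontier S) →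
    ∃ Y ∈ S, ball Y (c * r) ⊆ ball x r ∩ S

/-- The `2`-sided version of a geometric condition `P`: both `Ω` and the interior of its complement
satisfy `P`. -/
def TwoSided {X : Type*} [TopologicalSpace X] (P : Set X → Prop) (Ω : Set X) : Prop :=
  P Ω ∧ P (interior Ωᶜ)

/-- The distance `inf {|a - b| : a ∈ A, b ∈ B}` between two sets. -/
def setDist {X : Type*} [MetricSpace X] (A B : Set X) : ℝ≥0∞ :=
  ⨅ a ∈ A, infEDist a B

/-- The Harnack chain condition. The bound `M Λ` on the number `N` of balls depends only on `Λ`; the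
balls are `B_k = B(z k, s k)`, `1 ≤ k ≤ N`. -/
def HarnackChain {X : Type*} [MetricSpace X] (Θ : Set X) : Prop :=
  ∃ (C : ℝ) (M : ℝ → ℕ), 1 ≤ C ∧
    ∀ ρ : ℝ, 0 < ρ → ∀ Λ : ℝ, 1 ≤ Λ → ∀ Y ∈ Θ, ∀ Y' ∈ Θ,
      ENNReal.ofReal ρ ≤ infEDist Y (frontier Θ) →
      ENNReal.ofReal ρ ≤ infEDist Y' (frontier Θ) →
      dist Y Y' < Λ * ρ →
      ∃ (N : ℕ) (z : ℕ → X) (s : ℕ → ℝ), 1 ≤ N ∧ N ≤ M Λ ∧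
        Y ∈ ball (z 1) (s 1) ∧ Y' ∈ ball (z N) (s N) ∧
        (∀ k, 1 ≤ k → k < N → (ball (z k) (s k) ∩ ball (z (k + 1)) (s (k + 1))).Nonempty) ∧
        ∀ k, 1 ≤ k → k ≤ N → 0 < s k ∧ ball (z k) (s k) ⊆ Θ ∧
          (ENNReal.ofReal C)⁻¹ * ediam (ball (z k) (s k))
            ≤ setDist (ball (z k) (s k)) (frontier Θ) ∧
          setDist (ball (z k) (s k)) (frontier Θ)
            ≤ ENNReal.ofReal C * ediam (ball (z k) (s k))

/-- Non-tangentially accessible open sets in `ℝ^{n+1}`. Connectedness is not listed as a separate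
requirement, since the Harnack chain condition forces it when the boundary is non-empty. -/
structure IsNTA (n : ℕ) (Θ : Set (EuclideanSpace ℝ (Fin (n + 1)))) : Prop where
  isOpen : IsOpen Θ
  harnackChain : HarnackChain Θ
  corkscrew : Corkscrew Θ
  corkscrew_compl : Corkscrew Θᶜ

/-- Chord-arc domains in `ℝ^{n+1}`: NTA with `n`-Ahlfors--David regular boundary. -/
structure IsCAD (n : ℕ) (Ω : Set (EuclideanSpace ℝ (Fin (n + 1)))) : Prop where
  isNTA : IsNTA n Ω
  isADR : IsADR n (frontier Ω)

/-! ### Upper gradients and weak Poincaré inequalities -/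

/-- The length of a path. -/
def pathLength {X : Type*} [MetricSpace X] {x y : X} (γ : Path x y) : ℝ≥0∞ :=
  eVariationOn γ univ

/-- The arc-length parametrization (meaningful on `[0, ℓ(γ)]`, for rectifiable `γ`). -/
def arcLengthParam {X : Type*} [MetricSpace X] {x y : X} (γ : Path x y) : ℝ → X :=
  naturalParameterization γ univ 0

/-- The integral of a nonnegative function over a rectifiable path, by arc length. -/
def pathIntegral {X : Type*} [MetricSpace X] {x y : X} (ρ : X → ℝ≥0∞) (γ : Path x y) : ℝ≥0∞ :=
  ∫⁻ t in Icc 0 (pathLength γ).toReal, ρ (arcLengthParam γ t)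

/-- `ρ` is an upper gradient of `f`. -/
def IsUpperGradient {X : Type*} [MetricSpace X] [MeasurableSpace X]
    (f : X → ℝ) (ρ : X → ℝ≥0∞) : Prop :=
  Measurable ρ ∧ ∀ (x y : X) (γ : Path x y), pathLength γ ≠ ∞ →
    ENNReal.ofReal |f x - f y| ≤ pathIntegral ρ γ

/-- A metric measure space supports a weak (Heinonen--Koskela type) `p`-Poincaré inequality. The
right-hand side is allowed to be infinite. -/
def SupportsWeakPoincare {X : Type*} [MetricSpace X] [MeasurableSpace X]
    (μ : Measure X) (p : ℝ) : Prop :=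
  ∃ C Λ : ℝ, 1 ≤ C ∧ 1 ≤ Λ ∧ ∀ (y : X) (r : ℝ), 0 < r →
    ∀ f : X → ℝ, LocallyIntegrable f μ → ∀ ρ : X → ℝ≥0∞, IsUpperGradient f ρ →
      ⨍⁻ x in ball y r, ENNReal.ofReal |f x - ⨍ z in ball y r, f z ∂μ| ∂μ
        ≤ ENNReal.ofReal (C * r) * (⨍⁻ x in ball y (Λ * r), ρ x ^ p ∂μ) ^ (1 / p)

/-- The surface measure `σ = H^n` on `∂Ω`, as a measure on the metric space `∂Ω` (whose balls are the
surface balls `B(x,r) ∩ ∂Ω`). -/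
def surfaceMeasure (n : ℕ) (Ω : Set (EuclideanSpace ℝ (Fin (n + 1)))) : Measure (frontier Ω) :=
  (μH[(n : ℝ)] : Measure (EuclideanSpace ℝ (Fin (n + 1)))).comap Subtype.val

/-- `∂Ω` supports a weak `p`-Poincaré inequality. -/
def BoundarySupportsWeakPoincare (n : ℕ) (Ω : Set (EuclideanSpace ℝ (Fin (n + 1)))) (p : ℝ) :
    Prop :=
  SupportsWeakPoincare (surfaceMeasure n Ω) p

/-! ### The twice-pinched annulus -/

/-- Remove the strip `-1 < y < 1` from the two circles of radii `3` and `4`, and join the ends of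
the remaining arcs by two pairs of crossing segments, each segment joining an end of an inner arc to
an end of an outer arc on the other side of the strip. -/
def pinchedCurve : Set (EuclideanSpace ℝ (Fin 2)) :=
  ((sphere 0 3 ∪ sphere 0 4) \ {p | -1 < p 1 ∧ p 1 < 1}) ∪
    (segment ℝ !₂[Real.sqrt 8, 1] !₂[Real.sqrt 15, -1] ∪
      segment ℝ !₂[Real.sqrt 15, 1] !₂[Real.sqrt 8, -1]) ∪
    (segment ℝ !₂[-Real.sqrt 8, 1] !₂[-Real.sqrt 15, -1] ∪
      segment ℝ !₂[-Real.sqrt 15, 1] !₂[-Real.sqrt 8, -1])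

/-- The open region enclosed between the inner and the outer part of the pinched curve: outside the
strip it is the annulus `3 < |p| < 4`, and at height `y`, `-1 < y < 1`, it consists of the points
for which `|x|` is strictly between `(√15 + √8) / 2 - |y| (√15 - √8) / 2` and
`(√15 + √8) / 2 + |y| (√15 - √8) / 2`, the values of `|x|` on the two crossing segments. -/
def pinchedAnnulus : Set (EuclideanSpace ℝ (Fin 2)) :=
  {p | 1 ≤ |p 1| ∧ 3 < ‖p‖ ∧ ‖p‖ < 4} ∪
    {p | |p 1| < 1 ∧
      |(|p 0| - (Real.sqrt 15 + Real.sqrt 8) / 2)| < (Real.sqrt 15 - Real.sqrt 8) / 2 * |p 1|}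

end

/-! ### Chord-arc paths -/

/-! The region misses the line `y = 0` but has points on both sides of it, so it is disconnected,
and a Harnack chain condition would make it connected (`HarnackChain.isPreconnected`). Hence it is
not a chord-arc domain, and the converse already fails on the side of the region itself. Everything
else holds because the pinches are transversal crossings, not cusps.

Corkscrews: from each boundary point, all segments to some ball of fixed radius stay inside the
region, and likewise for the exterior (`hasInnerCone_pinchedAnnulus`,
`hasInnerCone_compl_closedPinchedAnnulus`). Contracting the ball towards the boundary point gives
corkscrew balls at all scales (`corkscrew_of_segments`).

Regularity and Poincaré: the curve is the union of four arcs, upper and lower, outer and inner, each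
containing both pinch points. Each arc is half of the unit sphere of a positively homogeneous gauge,
so radial projection from the `ℓ¹` sphere makes it a bi-Lipschitz image of `[-1, 1]`
(`isBilipschitzArc_pinchArc`). This gives the upper mass bound; the lower one follows from
connectedness. Two points of one arc are joined by a chord-arc path. Two points without a common arc
both lie within a multiple of their distance from one pinch point, and are joined through it
(`exists_pinchArc_or_abs_add_abs_le`, `exists_pinchPoint_between`). Such chains bound `|f x - f y|`
by the integral of an upper gradient over a ball of radius comparable to `dist x y`; with the upper
mass bound this is the `1`-Poincaré inequality (`supportsWeakPoincare_of_oscillation`). -/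

/-- A path all of whose subpaths have length at most `K` times the distance of their endpoints. -/
def IsChordArcPath {X : Type*} [MetricSpace X] {x y : X} (K : NNReal) (γ : Path x y) : Prop :=
  ∀ u u' : unitInterval, u ≤ u' → eVariationOn γ (Icc u u') ≤ K * edist (γ u) (γ u')

namespace IsChordArcPath

variable {X : Type*} [MetricSpace X] {x y : X} {K : NNReal} {γ : Path x y}

theorem pathLength_le (h : IsChordArcPath K γ) : pathLength γ ≤ K * edist x y := by
  have := h 0 1 zero_le_one
  rwa [γ.source, γ.target, show Icc (0 : unitInterval) 1 = univ from Icc_bot_top] at this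

theorem pathLength_ne_top (h : IsChordArcPath K γ) : pathLength γ ≠ ∞ :=
  ne_top_of_le_ne_top (ENNReal.mul_ne_top ENNReal.coe_ne_top (edist_ne_top _ _)) h.pathLength_le

theorem range_subset (h : IsChordArcPath K γ) : range γ ⊆ closedBall x (K * dist x y) := by
  rintro _ ⟨u, rfl⟩
  have h1 : edist (γ u) x ≤ eVariationOn γ univ := by
    simpa using eVariationOn.edist_le γ (mem_univ u) (mem_univ 0)
  have h2 := h1.trans h.pathLength_le
  rw [edist_dist, edist_dist, ← ENNReal.ofReal_coe_nnreal, ← ENNReal.ofReal_mul K.coe_nonneg] at h2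
  exact (ENNReal.ofReal_le_ofReal_iff (by positivity)).1 h2

theorem locallyBoundedVariationOn (h : IsChordArcPath K γ) :
    LocallyBoundedVariationOn γ univ :=
  BoundedVariationOn.locallyBoundedVariationOn h.pathLength_ne_top

/-- The length of the initial subpath, as a function of the parameter. -/
local notation "len" => variationOnFromTo γ univ (0 : unitInterval)

theorem abs_len_sub_le (h : IsChordArcPath K γ) (u u' : unitInterval) :
    |len u - len u'| ≤ K * dist (γ u) (γ u') := by
  wlog hu : u' ≤ u generalizing u u'
  · rw [abs_sub_comm, dist_comm]; exact this u' u (le_of_not_ge hu)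
  rw [variationOnFromTo.sub_right h.locallyBoundedVariationOn (mem_univ _) (mem_univ _)
    (mem_univ _), variationOnFromTo.eq_of_le _ _ hu, univ_inter, abs_of_nonneg ENNReal.toReal_nonneg]
  refine ENNReal.toReal_le_of_le_ofReal (by positivity) ?_
  rw [ENNReal.ofReal_mul K.coe_nonneg, ENNReal.ofReal_coe_nnreal, ← edist_dist, edist_comm]
  exact h u' u hu

theorem dist_le_abs_len_sub (h : IsChordArcPath K γ) (u u' : unitInterval) :
    dist (γ u) (γ u') ≤ |len u - len u'| := by
  wlog hu : u' ≤ u generalizing u u'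
  · rw [abs_sub_comm, dist_comm]; exact this u' u (le_of_not_ge hu)
  rw [variationOnFromTo.sub_right h.locallyBoundedVariationOn (mem_univ _) (mem_univ _)
    (mem_univ _), variationOnFromTo.eq_of_le _ _ hu, abs_of_nonneg ENNReal.toReal_nonneg,
    dist_edist]
  refine ENNReal.toReal_mono (h.locallyBoundedVariationOn _ _ (mem_univ _) (mem_univ _)) ?_
  exact eVariationOn.edist_le _ ⟨mem_univ _, hu, le_rfl⟩ ⟨mem_univ _, le_rfl, hu⟩

/-- `naturalParameterization` composes `γ` with a chosen inverse of the length function. The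
chord-arc bound makes length continuous, so every `t` in the interval is attained and the choice
never falls back on its default value. -/
theorem len_invFunOn (h : IsChordArcPath K γ) {t : ℝ}
    (ht : t ∈ Icc 0 (pathLength γ).toReal) :
    len (@Function.invFunOn _ _ ⟨0⟩ len univ t) = t := by
  have hc : Continuous len := by
    refine continuous_iff_continuousAt.2 fun u => ?_
    refine tendsto_iff_dist_tendsto_zero.2 ?_
    have h0 : Filter.Tendsto (fun u' => K * dist (γ u') (γ u)) (nhds u) (nhds (K * 0)) :=
      ((tendsto_iff_dist_tendsto_zero.1 (γ.continuous.tendsto u))).const_mul _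
    rw [mul_zero] at h0
    exact squeeze_zero (fun _ => dist_nonneg) (fun u' => h.abs_len_sub_le u' u) h0
  have h1 : len 1 = (pathLength γ).toReal := by
    rw [variationOnFromTo.eq_of_le _ _ zero_le_one,
      show Icc (0 : unitInterval) 1 = univ from Icc_bot_top, univ_inter]
    rfl
  have h2 := intermediate_value_univ (0 : unitInterval) 1 hc
  rw [variationOnFromTo.self, h1] at h2
  obtain ⟨u, hu⟩ := h2 ht
  have : Nonempty unitInterval := ⟨0⟩
  exact Function.invFunOn_eq ⟨u, mem_univ _, hu⟩

theorem dist_arcLengthParam_le (h : IsChordArcPath K γ) {t t' : ℝ}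
    (ht : t ∈ Icc 0 (pathLength γ).toReal) (ht' : t' ∈ Icc 0 (pathLength γ).toReal) :
    dist (arcLengthParam γ t) (arcLengthParam γ t') ≤ dist t t' := by
  have := h.dist_le_abs_len_sub (@Function.invFunOn _ _ ⟨0⟩ len univ t)
    (@Function.invFunOn _ _ ⟨0⟩ len univ t')
  rwa [h.len_invFunOn ht, h.len_invFunOn ht', ← Real.dist_eq] at this

theorem dist_le_arcLengthParam (h : IsChordArcPath K γ) {t t' : ℝ}
    (ht : t ∈ Icc 0 (pathLength γ).toReal) (ht' : t' ∈ Icc 0 (pathLength γ).toReal) :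
    dist t t' ≤ K * dist (arcLengthParam γ t) (arcLengthParam γ t') := by
  have := h.abs_len_sub_le (@Function.invFunOn _ _ ⟨0⟩ len univ t)
    (@Function.invFunOn _ _ ⟨0⟩ len univ t')
  rwa [h.len_invFunOn ht, h.len_invFunOn ht', ← Real.dist_eq] at this

variable [MeasurableSpace X] [BorelSpace X]

/-- The arc-length parametrization has a `K`-Lipschitz inverse, so it pushes Lebesgue measure to a
measure at most `K` times `H^1`, carried by a ball that contains the path. -/
theorem pathIntegral_le (h : IsChordArcPath K γ) {ρ : X → ℝ≥0∞} (hρ : Measurable ρ) :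
    pathIntegral ρ γ ≤ K * ∫⁻ z in closedBall x (K * dist x y), ρ z ∂μH[1] := by
  set I := Icc 0 (pathLength γ).toReal
  set g := arcLengthParam γ
  have hg : LipschitzOnWith 1 g I := LipschitzOnWith.of_dist_le_mul fun t ht t' ht' => by
    simpa using h.dist_arcLengthParam_le ht ht'
  have hgm : AEMeasurable g (volume.restrict I) := hg.continuousOn.aemeasurable measurableSet_Icc
  have hinj : InjOn g I := fun t ht t' ht' e => by
    have := h.dist_le_arcLengthParam ht ht'
    rw [show arcLengthParam γ t = arcLengthParam γ t' from e, dist_self, mul_zero] at this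
    exact dist_le_zero.1 this
  have hmap : Measure.map g (volume.restrict I) ≤
      (K : ℝ≥0∞) • (μH[1] : Measure X).restrict (closedBall x (K * dist x y)) := by
    refine Measure.le_iff.2 fun A hA => ?_
    rw [Measure.map_apply_of_aemeasurable hgm hA, Measure.smul_apply, smul_eq_mul,
      Measure.restrict_apply hA, Measure.restrict_apply₀' measurableSet_Icc.nullMeasurableSet]
    set E := g ⁻¹' A ∩ I
    have hL : LipschitzOnWith K (Function.invFunOn g I) (g '' I) := by
      refine LipschitzOnWith.of_dist_le_mul ?_
      rintro _ ⟨t, ht, rfl⟩ _ ⟨t', ht', rfl⟩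
      rw [hinj.leftInvOn_invFunOn ht, hinj.leftInvOn_invFunOn ht']
      exact h.dist_le_arcLengthParam ht ht'
    have hE : Function.invFunOn g I '' (g '' E) = E := by
      rw [image_image]
      refine (image_congr fun t ht => hinj.leftInvOn_invFunOn ht.2).trans (image_id' _)
    calc volume E = μH[1] (Function.invFunOn g I '' (g '' E)) := by
          rw [hE, hausdorffMeasure_real]
      _ ≤ (K : ℝ≥0∞) ^ (1 : ℝ) * μH[1] (g '' E) :=
          (hL.mono (image_mono inter_subset_right)).hausdorffMeasure_image_le zero_le_one
      _ ≤ K * μH[1] (A ∩ closedBall x (K * dist x y)) := by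
          rw [ENNReal.rpow_one]
          gcongr
          rintro _ ⟨t, ⟨htA, _⟩, rfl⟩
          exact ⟨htA, h.range_subset ⟨_, rfl⟩⟩
  calc pathIntegral ρ γ = ∫⁻ z, ρ z ∂(Measure.map g (volume.restrict I)) :=
        (lintegral_map' hρ.aemeasurable hgm).symm
    _ ≤ ∫⁻ z, ρ z ∂((K : ℝ≥0∞) • (μH[1] : Measure X).restrict (closedBall x (K * dist x y))) :=
        lintegral_mono' hmap le_rfl
    _ = _ := lintegral_smul_measure _ _

theorem ofReal_abs_sub_le (h : IsChordArcPath K γ) {f : X → ℝ} {ρ : X → ℝ≥0∞}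
    (hf : IsUpperGradient f ρ) :
    ENNReal.ofReal |f x - f y| ≤ K * ∫⁻ z in closedBall x (K * dist x y), ρ z ∂μH[1] :=
  (hf.2 x y γ h.pathLength_ne_top).trans (h.pathIntegral_le hf.1)

end IsChordArcPath

theorem exists_isChordArcPath_of_bilipschitz {X : Type*} [MetricSpace X] {φ : ℝ → X} {I : Set ℝ}
    (hI : Convex ℝ I) {K K' : NNReal} (h1 : LipschitzOnWith K φ I)
    (h2 : ∀ s ∈ I, ∀ t ∈ I, dist s t ≤ K' * dist (φ s) (φ t)) {s t : ℝ} (hs : s ∈ I)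
    (ht : t ∈ I) : ∃ γ : Path (φ s) (φ t), IsChordArcPath (K * K') γ := by
  have hmem : ∀ u : unitInterval, AffineMap.lineMap s t (u : ℝ) ∈ I := fun u =>
    hI.lineMap_mem hs ht u.2
  have hd : ∀ u v : unitInterval, dist (AffineMap.lineMap s t (u : ℝ) : ℝ)
      (AffineMap.lineMap s t (v : ℝ)) = dist s t * dist (u : ℝ) v := fun u v => by
    rw [dist_lineMap_lineMap, mul_comm]
  let g : unitInterval → X := fun u => φ (AffineMap.lineMap s t (u : ℝ))
  have hg : LipschitzWith (K * nndist s t) g := LipschitzWith.of_dist_le_mul fun u v => by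
    have := h1.dist_le_mul _ (hmem u) _ (hmem v)
    rw [hd, ← mul_assoc] at this
    exact this
  refine ⟨⟨⟨g, hg.continuous⟩, by simp [g], by simp [g]⟩, fun u u' hu => ?_⟩
  change eVariationOn g (Icc u u') ≤ _
  have e1 : eVariationOn (fun v : unitInterval => (v : ℝ)) (Icc u u') = ENNReal.ofReal ((u' : ℝ) - u) := by
    have := MonotoneOn.eVariationOn_eq (f := fun v : unitInterval => (v : ℝ)) (s := univ)
      (a := u) (b := u') (fun _ _ _ _ h => h) (mem_univ _) (mem_univ _)
    rwa [univ_inter] at this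
  have e2 : eVariationOn g (Icc u u') ≤ (K * nndist s t : NNReal) * ENNReal.ofReal ((u' : ℝ) - u) := by
    rw [← e1]
    refine iSup_le ?_
    rintro ⟨n, w, hw, ws⟩
    refine (Finset.sum_le_sum fun i _ => hg (w (i + 1)) (w i)).trans ?_
    rw [← Finset.mul_sum]
    gcongr
    exact eVariationOn.sum_le (f := fun v : unitInterval => (v : ℝ)) hw ws
  refine e2.trans ?_
  change _ ≤ _ * edist (g u) (g u')
  have h3 := h2 _ (hmem u) _ (hmem u')
  rw [hd] at h3
  rw [edist_dist, ← ENNReal.ofReal_coe_nnreal, ← ENNReal.ofReal_coe_nnreal, ← ENNReal.ofReal_mul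
    (by positivity), ← ENNReal.ofReal_mul (by positivity)]
  refine ENNReal.ofReal_le_ofReal ?_
  have h4 : dist (u : ℝ) u' = u' - u := by
    rw [dist_comm, Real.dist_eq, abs_of_nonneg (sub_nonneg.2 (Subtype.coe_le_coe.2 hu))]
  rw [h4] at h3
  push_cast
  rw [mul_assoc, mul_assoc]
  exact mul_le_mul_of_nonneg_left h3 K.2

/-! ### Poincaré inequalities from chord-arc chains -/

/-- The pointwise estimate bounds the oscillation of `f` on `B(y,r)` by `M = K ∫ ρ` over `B(y,Λr)`.
The upper growth of `μ` turns `M` into a multiple of `r` times the average of `ρ`; no lower mass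
bound is needed. -/
theorem supportsWeakPoincare_of_oscillation {X : Type*} [MetricSpace X] [MeasurableSpace X]
    [BorelSpace X] [SecondCountableTopology X] {μ : Measure X} {D : ℝ} {K : NNReal} (hD : 1 ≤ D)
    (hμ : ∀ (x : X) (r : ℝ), 0 < r → μ (ball x r) ≤ ENNReal.ofReal (D * r))
    (hosc : ∀ (f : X → ℝ) (ρ : X → ℝ≥0∞), IsUpperGradient f ρ → ∀ x y,
      ENNReal.ofReal |f x - f y| ≤ K * ∫⁻ z in closedBall x (K * dist x y), ρ z ∂μ) :
    SupportsWeakPoincare μ 1 := by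
  -- For `x, z` in `B(y,r)`, the closed ball about `x` of radius `K * dist x z ≤ 2Kr` lies in
  -- `B(y,(2K+2)r)`.
  set Λ : ℝ := 2 * K + 2
  have hK : (0 : ℝ) ≤ K := K.2
  have hΛ : 2 ≤ Λ := by simp only [Λ]; linarith
  have hKD : 0 ≤ K * D * Λ := by positivity
  refine ⟨K * D * Λ + 1, Λ, by linarith, by linarith, fun y r hr f hf ρ hρ => ?_⟩
  simp only [ENNReal.rpow_one, div_one]
  set M : ℝ≥0∞ := K * ∫⁻ z in ball y (Λ * r), ρ z ∂μ with hM
  have hB := hμ y r hr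
  have hΛr : 0 < Λ * r := by positivity
  rcases eq_or_ne (μ (ball y r)) 0 with h0 | h0
  · rw [setLAverage_eq, setLIntegral_measure_zero _ _ h0, ENNReal.zero_div]; exact zero_le
  have hBtop : μ (ball y r) ≠ ∞ := ne_top_of_le_ne_top ENNReal.ofReal_ne_top hB
  have hB'top : μ (ball y (Λ * r)) ≠ ∞ :=
    ne_top_of_le_ne_top ENNReal.ofReal_ne_top (hμ y _ hΛr)
  have hB'0 : μ (ball y (Λ * r)) ≠ 0 := fun h => h0 <|
    measure_mono_null (ball_subset_ball (by nlinarith)) h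
  have hpt : ∀ x ∈ ball y r, ∀ z ∈ ball y r, ENNReal.ofReal |f x - f z| ≤ M := by
    intro x hx z hz
    refine (hosc f ρ hρ x z).trans ?_
    rw [hM]
    gcongr
    refine closedBall_subset_ball' ?_
    rw [mem_ball] at hx hz
    have : dist x z ≤ 2 * r := by linarith [dist_triangle_right x z y]
    have := mul_le_mul_of_nonneg_left this hK
    simp only [Λ]
    nlinarith
  have hMr : M ≤ ENNReal.ofReal ((K * D * Λ + 1) * r) * ⨍⁻ x in ball y (Λ * r), ρ x ∂μ := by
    rw [setLAverage_eq, hM, ← mul_div_assoc, ENNReal.le_div_iff_mul_le (.inl hB'0) (.inl hB'top),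
      mul_right_comm]
    gcongr
    refine (mul_le_mul_right (hμ y _ hΛr) _).trans ?_
    rw [← ENNReal.ofReal_coe_nnreal, ← ENNReal.ofReal_mul hK]
    refine ENNReal.ofReal_le_ofReal ?_
    nlinarith
  refine le_trans ?_ hMr
  rcases eq_or_ne M ∞ with hMt | hMt
  · rw [hMt]; exact le_top
  have hpt' : ∀ x ∈ ball y r, ∀ z ∈ ball y r, |f z - f x| ≤ M.toReal := fun x hx z hz =>
    (ENNReal.ofReal_le_iff_le_toReal hMt).1 (hpt z hz x hx)
  -- Local integrability supplies measurability and the oscillation bound supplies boundedness.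
  -- Without integrability the Bochner average would be `0` by convention.
  have hint : IntegrableOn f (ball y r) μ := by
    refine IntegrableOn.of_bound hBtop.lt_top ?_ (|f y| + M.toReal) ?_
    · exact hf.aestronglyMeasurable.restrict
    · refine (ae_restrict_iff' measurableSet_ball).2 (.of_forall fun z hz => ?_)
      have := hpt' y (mem_ball_self hr) z hz
      have h2 := abs_sub_abs_le_abs_sub (f z) (f y)
      rw [Real.norm_eq_abs]; linarith
  rw [setLAverage_eq]
  refine ENNReal.div_le_of_le_mul ?_
  rw [← setLIntegral_const]
  refine setLIntegral_mono' measurableSet_ball fun x hx => ?_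
  have hav : (⨍ z in ball y r, f z ∂μ) ∈ closedBall (f x) M.toReal :=
    (convex_closedBall _ _).set_average_mem isClosed_closedBall h0 hBtop
      ((ae_restrict_iff' measurableSet_ball).2 (.of_forall fun z hz => hpt' x hx z hz)) hint
  rw [mem_closedBall, dist_comm, Real.dist_eq] at hav
  exact (ENNReal.ofReal_le_iff_le_toReal hMt).2 hav

theorem supportsWeakPoincare_hausdorffMeasure_one_of_chains {X : Type*} [MetricSpace X]
    [MeasurableSpace X] [BorelSpace X] [SecondCountableTopology X] {D : ℝ} {K K' : NNReal} (hD : 1 ≤ D)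
    (hμ : ∀ (x : X) (r : ℝ), 0 < r → μH[1] (ball x r) ≤ ENNReal.ofReal (D * r))
    (hchain : ∀ x y : X, ∃ p : X, (∃ γ : Path x p, IsChordArcPath K γ) ∧
      (∃ γ : Path p y, IsChordArcPath K γ) ∧ dist x p ≤ K' * dist x y ∧
      dist p y ≤ K' * dist x y) :
    SupportsWeakPoincare (μH[1] : Measure X) 1 := by
  -- `2K` pays for the sum of the two legs; `K * K' + K'` is the radius about `x` needed for the
  -- ball about `p` of the second leg.
  refine supportsWeakPoincare_of_oscillation (K := 2 * K + K * K' + K') hD hμ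
    fun f ρ hf x y => ?_
  obtain ⟨p, ⟨γ, hγ⟩, ⟨γ', hγ'⟩, h1, h2⟩ := hchain x y
  have hd : 0 ≤ dist x y := dist_nonneg
  have hK : (0 : ℝ) ≤ K := K.2
  have hK' : (0 : ℝ) ≤ K' := K'.2
  have i1 : ENNReal.ofReal |f x - f p| ≤ K *
      ∫⁻ z in closedBall x ((2 * K + K * K' + K' : NNReal) * dist x y), ρ z ∂μH[1] := by
    refine (hγ.ofReal_abs_sub_le hf).trans
      (mul_le_mul' le_rfl (lintegral_mono_set (closedBall_subset_closedBall ?_)))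
    push_cast
    nlinarith [mul_le_mul_of_nonneg_left h1 hK, mul_nonneg hK hd, mul_nonneg hK' hd]
  have i2 : ENNReal.ofReal |f p - f y| ≤ K *
      ∫⁻ z in closedBall x ((2 * K + K * K' + K' : NNReal) * dist x y), ρ z ∂μH[1] := by
    refine (hγ'.ofReal_abs_sub_le hf).trans ?_
    gcongr
    refine closedBall_subset_closedBall' ?_
    push_cast
    rw [dist_comm p x]
    nlinarith [mul_le_mul_of_nonneg_left h2 hK, mul_nonneg hK hd, mul_nonneg hK' hd]
  calc ENNReal.ofReal |f x - f y| ≤ ENNReal.ofReal (|f x - f p| + |f p - f y|) :=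
        ENNReal.ofReal_le_ofReal (abs_sub_le _ _ _)
    _ ≤ _ := ENNReal.ofReal_add_le
    _ ≤ _ := add_le_add i1 i2
    _ = (2 * K : NNReal) * ∫⁻ z in closedBall x ((2 * K + K * K' + K' : NNReal) * dist x y),
          ρ z ∂μH[1] := by push_cast; ring
    _ ≤ _ := by
        gcongr
        rw [add_assoc]
        exact le_self_add

/-! ### Ahlfors--David regularity -/

/-- The distance to `x` is `1`-Lipschitz and, on a connected set reaching distance `s`, takes all
values in `[0, s)`; Lipschitz maps of constant one do not increase `H^1`. -/
theorem IsPreconnected.ofReal_le_hausdorffMeasure_ball_inter {X : Type*} [MetricSpace X]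
    [MeasurableSpace X] [BorelSpace X] {E : Set X} (hE : IsPreconnected E) {x y : X} (hx : x ∈ E)
    (hy : y ∈ E) {s r : ℝ} (hsr : s ≤ r) (hs : s ≤ dist y x) :
    ENNReal.ofReal s ≤ μH[1] (ball x r ∩ E) := by
  have hsub : Ico 0 s ⊆ (fun z => dist z x) '' (ball x r ∩ E) := fun t ht => by
    have h1 : IsPreconnected ((fun z => dist z x) '' E) :=
      hE.image _ (by fun_prop)
    obtain ⟨z, hz, hzt⟩ := h1.Icc_subset ⟨x, hx, dist_self x⟩ ⟨y, hy, rfl⟩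
      ⟨ht.1, ht.2.le.trans hs⟩
    exact ⟨z, ⟨mem_ball.2 (hzt.trans_lt (ht.2.trans_le hsr)), hz⟩, hzt⟩
  calc ENNReal.ofReal s = μH[1] (Ico 0 s) := by
        rw [hausdorffMeasure_real, Real.volume_Ico, sub_zero]
    _ ≤ μH[1] ((fun z => dist z x) '' (ball x r ∩ E)) := measure_mono hsub
    _ ≤ _ := by
        simpa using (LipschitzWith.dist_left x).hausdorffMeasure_image_le zero_le_one (ball x r ∩ E)

/-- The parameters landing in the ball form a set of diameter at most `2 K' r`, hence of at most
that Lebesgue measure, and `φ` expands `H^1` by at most `K`. -/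
theorem hausdorffMeasure_ball_inter_image_le {X : Type*} [MetricSpace X]
    [MeasurableSpace X] [BorelSpace X] {φ : ℝ → X} {I : Set ℝ} {K K' : NNReal}
    (h1 : LipschitzOnWith K φ I) (h2 : ∀ s ∈ I, ∀ t ∈ I, dist s t ≤ K' * dist (φ s) (φ t))
    (x : X) (r : ℝ) :
    μH[1] (ball x r ∩ φ '' I) ≤ ENNReal.ofReal (2 * K * K' * r) := by
  rcases le_or_gt r 0 with hr | hr
  · simp [ball_eq_empty.2 hr]
  set S := I ∩ φ ⁻¹' ball x r
  have hS : ball x r ∩ φ '' I ⊆ φ '' S := by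
    rintro _ ⟨hb, t, ht, rfl⟩
    exact ⟨t, ⟨ht, hb⟩, rfl⟩
  have hd : ediam S ≤ ENNReal.ofReal (2 * K' * r) := by
    refine ediam_le fun s hs t ht => ?_
    rw [edist_dist]
    refine ENNReal.ofReal_le_ofReal ((h2 s hs.1 t ht.1).trans ?_)
    have h3 : dist (φ s) (φ t) ≤ 2 * r := by
      linarith [dist_triangle_right (φ s) (φ t) x, mem_ball.1 hs.2, mem_ball.1 ht.2]
    nlinarith [mul_le_mul_of_nonneg_left h3 K'.2]
  calc μH[1] (ball x r ∩ φ '' I) ≤ μH[1] (φ '' S) := measure_mono hS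
    _ ≤ (K : ℝ≥0∞) ^ (1 : ℝ) * μH[1] S :=
        (h1.mono inter_subset_left).hausdorffMeasure_image_le zero_le_one
    _ ≤ K * ENNReal.ofReal (2 * K' * r) := by
        rw [ENNReal.rpow_one, hausdorffMeasure_real]
        gcongr
        exact (Real.volume_le_diam S).trans hd
    _ = ENNReal.ofReal (2 * K * K' * r) := by
        rw [← ENNReal.ofReal_coe_nnreal, ← ENNReal.ofReal_mul K.coe_nonneg]
        ring_nf

theorem isADR_one_of_isPreconnected {X : Type*} [MetricSpace X] [MeasurableSpace X] [BorelSpace X]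
    {E : Set X} (hc : IsClosed E) (hE : IsPreconnected E) {D : ℝ}
    (hD : ∀ x ∈ E, ∀ r : ℝ, 0 < r → μH[1] (ball x r ∩ E) ≤ ENNReal.ofReal (D * r)) :
    IsADR 1 E := by
  refine ⟨hc, max 2 D, le_max_of_le_left one_le_two, fun x hx r hr hrE => ?_⟩
  rw [Nat.cast_one, pow_one]
  refine ⟨?_, (hD x hx r hr).trans (ENNReal.ofReal_le_ofReal (by gcongr; exact le_max_right _ _))⟩
  -- If all of `E` were within `r / 2` of `x`, its diameter would be at most `r`. This half is the
  -- source of the constant `2`.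
  obtain ⟨y, hy, hxy⟩ : ∃ y ∈ E, r / 2 ≤ dist y x := by
    by_contra! h
    refine hrE.not_ge (ediam_le fun y hy z hz => ?_)
    rw [edist_dist]
    refine ENNReal.ofReal_le_ofReal ?_
    linarith [dist_triangle_right y z x, h y hy, h z hz]
  refine le_trans (ENNReal.ofReal_le_ofReal ?_)
    (IsPreconnected.ofReal_le_hausdorffMeasure_ball_inter hE hx hy (by linarith : r / 2 ≤ r) hxy)
  gcongr
  exact le_max_left _ _

theorem surfaceMeasure_one_eq (Ω : Set (EuclideanSpace ℝ (Fin 2))) :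
    surfaceMeasure 1 Ω = μH[1] := by
  ext s hs
  rw [surfaceMeasure, Nat.cast_one, (MeasurableEmbedding.subtype_coe
    isClosed_frontier.measurableSet).comap_apply,
    isometry_subtype_coe.hausdorffMeasure_image (.inl zero_le_one)]

/-! ### Corkscrew and Harnack chain conditions -/

/-- The homothety with centre `x` and ratio `t = r / (3R)` sends `B(T,c)` to a ball of radius `(c /
(3R)) r` inside `S`. The ratio is below one since `r < diam ≤ 2R`, and the image lies in `B(x,r)`
since its points are within `t (2R + c) ≤ r` of `x`. -/
theorem corkscrew_of_segments {E : Type*} [NormedAddCommGroup E] [NormedSpace ℝ E] {S : Set E}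
    {c R : ℝ} (hc : 0 < c) (hcR : c ≤ R) (hR : ∀ x ∈ frontier S, ‖x‖ ≤ R)
    (h : ∀ x ∈ frontier S, ∃ T, ‖T‖ ≤ R ∧
      ∀ z ∈ ball T c, ∀ t : ℝ, 0 < t → t ≤ 1 → x + t • (z - x) ∈ S) :
    Corkscrew S := by
  have hR0 : 0 < R := hc.trans_le hcR
  refine ⟨c / (3 * R), by positivity, fun x hx r hr hrd => ?_⟩
  have hr2 : r < 2 * R := by
    refine (ENNReal.ofReal_lt_ofReal_iff (by positivity)).1 (hrd.trans_le (ediam_le fun y hy z hz => ?_))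
    rw [edist_dist]
    refine ENNReal.ofReal_le_ofReal ?_
    rw [dist_eq_norm]
    linarith [norm_sub_le y z, hR y hy, hR z hz]
  obtain ⟨T, hT, hseg⟩ := h x hx
  set t := r / (3 * R) with ht
  have ht0 : 0 < t := by positivity
  have ht1 : t ≤ 1 := by rw [ht, div_le_one (by positivity)]; linarith
  have htR : t * (3 * R) = r := by rw [ht]; field_simp
  have hcr : c / (3 * R) * r = t * c := by rw [ht]; ring
  rw [hcr]
  refine ⟨x + t • (T - x), hseg T (mem_ball_self hc) t ht0 ht1, fun Y hY => ?_⟩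
  rw [mem_ball, dist_eq_norm] at hY
  constructor
  · rw [mem_ball, dist_eq_norm]
    have e : Y - x = (Y - (x + t • (T - x))) + t • (T - x) := by abel
    have h1 : ‖t • (T - x)‖ ≤ t * (2 * R) := by
      rw [norm_smul, Real.norm_of_nonneg ht0.le]
      gcongr
      linarith [norm_sub_le T x, hR x hx]
    rw [e]
    have h2 : t * c ≤ t * R := by gcongr
    refine (norm_add_le _ _).trans_lt ?_
    nlinarith
  · have e : Y = x + t • ((T + t⁻¹ • (Y - (x + t • (T - x)))) - x) := by
      rw [add_sub_right_comm, smul_add, smul_inv_smul₀ ht0.ne']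
      abel
    rw [e]
    refine hseg _ ?_ t ht0 ht1
    rw [mem_ball, dist_eq_norm, add_sub_cancel_left, norm_smul, norm_inv,
      Real.norm_of_nonneg ht0.le, inv_mul_lt_iff₀ ht0]
    exact hY

/-- Any two points of an open set have positive (possibly infinite) distance to the frontier, so
some `ρ` and `Λ` apply to them; a chain of successively intersecting balls is connected. -/
theorem HarnackChain.isPreconnected {E : Type*} [NormedAddCommGroup E] [NormedSpace ℝ E]
    {Θ : Set E} (hΘ : HarnackChain Θ) (ho : IsOpen Θ) : IsPreconnected Θ := by
  obtain ⟨C, M, -, h⟩ := hΘ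
  refine isPreconnected_of_forall_pair fun Y hY Y' hY' => ?_
  have hpos : ∀ Z ∈ Θ, 0 < infEDist Z (frontier Θ) := fun Z hZ => by
    rw [pos_iff_ne_zero, ne_eq, ← mem_closure_iff_infEDist_zero.not, isClosed_frontier.closure_eq,
      ho.frontier_eq]
    exact fun hh => hh.2 hZ
  obtain ⟨ρ, hρ0, hρ⟩ := ENNReal.lt_iff_exists_nnreal_btwn.1
    (lt_min (hpos Y hY) (hpos Y' hY'))
  have hρ0' : (0 : ℝ) < ρ := by exact_mod_cast hρ0
  rw [← ENNReal.ofReal_coe_nnreal] at hρ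
  obtain ⟨N, z, s, hN, -, hYz, hYz', hchain, hball⟩ := h ρ hρ0' (dist Y Y' / ρ + 1)
    (by have : 0 ≤ dist Y Y' / ρ := by positivity
        linarith) Y hY Y' hY' (hρ.le.trans (min_le_left _ _))
    (hρ.le.trans (min_le_right _ _)) (by rw [add_mul, div_mul_cancel₀ _ hρ0'.ne']; linarith)
  refine ⟨⋃ k ∈ Icc 1 N, ball (z k) (s k), iUnion₂_subset fun k hk => (hball k hk.1 hk.2).2.1,
    mem_biUnion ⟨le_rfl, hN⟩ hYz, mem_biUnion ⟨hN, le_rfl⟩ hYz', ?_⟩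
  refine IsPreconnected.biUnion_of_chain ordConnected_Icc
    (fun k _ => (convex_ball _ _).isPreconnected) fun k hk hk' => ?_
  exact hchain k hk.1 (Nat.lt_of_succ_le hk'.2)

/-! ### The pinched annulus and its boundary -/

/-- The abscissa of the right pinch point. -/
noncomputable def pinchAbscissa : ℝ := (Real.sqrt 15 + Real.sqrt 8) / 2

/-- The reciprocal slope of the segments through the pinch points. -/
noncomputable def pinchSlope : ℝ := (Real.sqrt 15 - Real.sqrt 8) / 2

local notation "𝐦" => pinchAbscissa
local notation "𝐤" => pinchSlope
local notation "ℝ²" => EuclideanSpace ℝ (Fin 2)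

/-- `𝐦 + 𝐤` and `𝐦 - 𝐤` are the abscissas at which the circles of radii `4` and `3` meet height one.
These squares and the bounds of `pinch_bounds` are used below in place of the radicals. -/
theorem pinchAbscissa_add_sq : (𝐦 + 𝐤) ^ 2 = 15 := by
  have := Real.sq_sqrt (show (0 : ℝ) ≤ 15 by norm_num)
  unfold pinchAbscissa pinchSlope
  linarith [this, show ((Real.sqrt 15 + Real.sqrt 8) / 2 + (Real.sqrt 15 - Real.sqrt 8) / 2) ^ 2
    = Real.sqrt 15 ^ 2 by ring]

theorem pinchAbscissa_sub_sq : (𝐦 - 𝐤) ^ 2 = 8 := by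
  have := Real.sq_sqrt (show (0 : ℝ) ≤ 8 by norm_num)
  unfold pinchAbscissa pinchSlope
  linarith [this, show ((Real.sqrt 15 + Real.sqrt 8) / 2 - (Real.sqrt 15 - Real.sqrt 8) / 2) ^ 2
    = Real.sqrt 8 ^ 2 by ring]

theorem pinchAbscissa_mul_pinchSlope : 𝐦 * 𝐤 = 7 / 4 := by
  linarith [pinchAbscissa_add_sq, pinchAbscissa_sub_sq,
    show 𝐦 * 𝐤 = ((𝐦 + 𝐤) ^ 2 - (𝐦 - 𝐤) ^ 2) / 4 by ring]

theorem pinchAbscissa_sq_add_pinchSlope_sq : 𝐦 ^ 2 + 𝐤 ^ 2 = 23 / 2 := by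
  linarith [pinchAbscissa_add_sq, pinchAbscissa_sub_sq,
    show 𝐦 ^ 2 + 𝐤 ^ 2 = ((𝐦 + 𝐤) ^ 2 + (𝐦 - 𝐤) ^ 2) / 2 by ring]

theorem pinch_bounds : (3.34 < 𝐦 ∧ 𝐦 < 3.36) ∧ 0.51 < 𝐤 ∧ 𝐤 < 0.53 := by
  have h1 : 3.872 < Real.sqrt 15 := Real.lt_sqrt_of_sq_lt (by norm_num)
  have h2 : Real.sqrt 15 < 3.873 := (Real.sqrt_lt' (by norm_num)).2 (by norm_num)
  have h3 : 2.828 < Real.sqrt 8 := Real.lt_sqrt_of_sq_lt (by norm_num)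
  have h4 : Real.sqrt 8 < 2.829 := (Real.sqrt_lt' (by norm_num)).2 (by norm_num)
  unfold pinchAbscissa pinchSlope
  refine ⟨⟨?_, ?_⟩, ?_, ?_⟩ <;> linarith

theorem norm_sq_eq_coord (p : ℝ²) : ‖p‖ ^ 2 = p 0 ^ 2 + p 1 ^ 2 := by
  simp [EuclideanSpace.norm_sq_eq]

theorem abs_coord_le_norm (p : ℝ²) (i : Fin 2) : |p i| ≤ ‖p‖ := by
  simpa using PiLp.norm_apply_le p i

theorem norm_le_abs_add_abs (p : ℝ²) : ‖p‖ ≤ |p 0| + |p 1| := by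
  refine abs_le_of_sq_le_sq' ?_ (by positivity) |>.2
  rw [norm_sq_eq_coord, ← sq_abs (p 0), ← sq_abs (p 1)]
  nlinarith [mul_nonneg (abs_nonneg (p 0)) (abs_nonneg (p 1))]

theorem lt_norm_iff_coord (p : ℝ²) {r : ℝ} (hr : 0 ≤ r) : r < ‖p‖ ↔ r ^ 2 < |p 0| ^ 2 + |p 1| ^ 2 := by
  rw [sq_abs, sq_abs, ← norm_sq_eq_coord, pow_lt_pow_iff_left₀ hr (norm_nonneg _) two_ne_zero]

theorem norm_lt_iff_coord (p : ℝ²) {r : ℝ} (hr : 0 ≤ r) : ‖p‖ < r ↔ |p 0| ^ 2 + |p 1| ^ 2 < r ^ 2 := by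
  rw [sq_abs, sq_abs, ← norm_sq_eq_coord, pow_lt_pow_iff_left₀ (norm_nonneg _) hr two_ne_zero]

theorem mem_segment_one_neg_one_iff (x y : ℝ) (p : ℝ²) :
    p ∈ segment ℝ (!₂[x, 1] : ℝ²) !₂[y, -1] ↔
      |p 1| ≤ 1 ∧ p 0 = (x + y) / 2 + (x - y) / 2 * p 1 := by
  constructor
  · rintro ⟨s, t, hs, ht, hst, rfl⟩
    simp only [PiLp.add_apply, PiLp.smul_apply, Matrix.cons_val_zero, Matrix.cons_val_one,
      smul_eq_mul, Fin.isValue, mul_one, mul_neg]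
    obtain rfl : t = 1 - s := by linarith
    exact ⟨abs_le.2 ⟨by linarith, by linarith⟩, by ring⟩
  · rintro ⟨h1, h0⟩
    rw [abs_le] at h1
    refine ⟨(1 + p 1) / 2, (1 - p 1) / 2, by linarith, by linarith, by ring, ?_⟩
    ext i
    fin_cases i
    · simp [h0]; ring
    · simp; ring

theorem mem_pinchedCurve_iff (p : ℝ²) : p ∈ pinchedCurve ↔
    (1 ≤ |p 1| ∧ (‖p‖ = 3 ∨ ‖p‖ = 4)) ∨ (|p 1| ≤ 1 ∧ |(|p 0| - 𝐦)| = 𝐤 * |p 1|) := by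
  obtain ⟨⟨hm, -⟩, hk, hk'⟩ := pinch_bounds
  have hstrip : p ∉ {p : ℝ² | -1 < p 1 ∧ p 1 < 1} ↔ 1 ≤ |p 1| := by
    rw [mem_ofPred_eq, ← abs_lt, not_lt]
  have hseg : |p 1| ≤ 1 → (|(|p 0| - 𝐦)| = 𝐤 * |p 1| ↔
      ((p 0 = 𝐦 - 𝐤 * p 1 ∨ p 0 = 𝐦 + 𝐤 * p 1) ∨
        (p 0 = -𝐦 + 𝐤 * p 1 ∨ p 0 = -𝐦 - 𝐤 * p 1))) := fun h => by
    rw [abs_le] at h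
    rw [show 𝐤 * |p 1| = |𝐤 * p 1| by rw [abs_mul, abs_of_pos (by linarith : 0 < 𝐤)],
      abs_eq_abs, sub_eq_iff_eq_add, sub_eq_iff_eq_add,
      abs_eq (by nlinarith), abs_eq (by nlinarith)]
    constructor
    · rintro ((h | h) | (h | h))
      · exact .inl (.inr (by linarith))
      · exact .inr (.inr (by linarith))
      · exact .inl (.inl (by linarith))
      · exact .inr (.inl (by linarith))
    · rintro ((h | h) | (h | h))
      · exact .inr (.inl (by linarith))
      · exact .inl (.inl (by linarith))
      · exact .inr (.inr (by linarith))
      · exact .inl (.inr (by linarith))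
  unfold pinchedCurve
  rw [mem_union, mem_union, mem_union, mem_union, mem_segment_one_neg_one_iff,
    mem_segment_one_neg_one_iff, mem_segment_one_neg_one_iff, mem_segment_one_neg_one_iff,
    mem_sdiff, hstrip, mem_union, mem_sphere_zero_iff_norm, mem_sphere_zero_iff_norm,
    show (Real.sqrt 8 + Real.sqrt 15) / 2 = 𝐦 by unfold pinchAbscissa; ring,
    show (Real.sqrt 15 + Real.sqrt 8) / 2 = 𝐦 by unfold pinchAbscissa; ring,
    show (Real.sqrt 8 - Real.sqrt 15) / 2 = -𝐤 by unfold pinchSlope; ring,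
    show (Real.sqrt 15 - Real.sqrt 8) / 2 = 𝐤 by unfold pinchSlope; ring,
    show (-Real.sqrt 8 + -Real.sqrt 15) / 2 = -𝐦 by unfold pinchAbscissa; ring,
    show (-Real.sqrt 15 + -Real.sqrt 8) / 2 = -𝐦 by unfold pinchAbscissa; ring,
    show (-Real.sqrt 8 - -Real.sqrt 15) / 2 = 𝐤 by unfold pinchSlope; ring,
    show (-Real.sqrt 15 - -Real.sqrt 8) / 2 = -𝐤 by unfold pinchSlope; ring]
  simp only [neg_mul, ← sub_eq_add_neg]
  rw [and_congr_right hseg, and_comm (a := 1 ≤ _)]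
  simp only [and_or_left, or_assoc]

theorem mem_pinchedAnnulus_iff (p : ℝ²) : p ∈ pinchedAnnulus ↔
    (1 ≤ |p 1| ∧ 3 < ‖p‖ ∧ ‖p‖ < 4) ∨ (|p 1| < 1 ∧ |(|p 0| - 𝐦)| < 𝐤 * |p 1|) :=
  Iff.rfl

/-- At height one the two descriptions of the pinched annulus agree. -/
theorem norm_iff_of_abs_eq_one (p : ℝ²) (h : |p 1| = 1) :
    (3 < ‖p‖ ↔ 𝐦 - 𝐤 < |p 0|) ∧ (‖p‖ < 3 ↔ |p 0| < 𝐦 - 𝐤) ∧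
    (4 < ‖p‖ ↔ 𝐦 + 𝐤 < |p 0|) ∧ (‖p‖ < 4 ↔ |p 0| < 𝐦 + 𝐤) := by
  obtain ⟨⟨hm, -⟩, hk, hk'⟩ := pinch_bounds
  have h0 := abs_nonneg (p 0)
  rw [lt_norm_iff_coord p (by norm_num), norm_lt_iff_coord p (by norm_num),
    lt_norm_iff_coord p (by norm_num), norm_lt_iff_coord p (by norm_num), h,
    ← pow_lt_pow_iff_left₀ (by linarith : 0 ≤ 𝐦 - 𝐤) h0 two_ne_zero,
    ← pow_lt_pow_iff_left₀ h0 (by linarith : 0 ≤ 𝐦 - 𝐤) two_ne_zero,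
    ← pow_lt_pow_iff_left₀ (by linarith : 0 ≤ 𝐦 + 𝐤) h0 two_ne_zero,
    ← pow_lt_pow_iff_left₀ h0 (by linarith : 0 ≤ 𝐦 + 𝐤) two_ne_zero,
    pinchAbscissa_add_sq, pinchAbscissa_sub_sq]
  refine ⟨?_, ?_, ?_, ?_⟩ <;> constructor <;> intro <;> linarith

/-- The closed region enclosed between the two parts of the pinched curve. -/
def closedPinchedAnnulus : Set ℝ² :=
  {p | (1 ≤ |p 1| ∧ 3 ≤ ‖p‖ ∧ ‖p‖ ≤ 4) ∨ (|p 1| ≤ 1 ∧ |(|p 0| - 𝐦)| ≤ 𝐤 * |p 1|)}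

theorem isClosed_closedPinchedAnnulus : IsClosed closedPinchedAnnulus := by
  have h0 : Continuous fun p : ℝ² => p 0 := by fun_prop
  have h1 : Continuous fun p : ℝ² => p 1 := by fun_prop
  refine IsClosed.union ?_ ?_
  · exact (isClosed_le continuous_const h1.abs).inter ((isClosed_le continuous_const
      continuous_norm).inter (isClosed_le continuous_norm continuous_const))
  · exact (isClosed_le h1.abs continuous_const).inter (isClosed_le
      (h0.abs.sub continuous_const).abs (continuous_const.mul h1.abs))

/-- Both pieces have non-strict conditions, which exhibits the complement as closed. At height one
both apply, and they agree by `norm_iff_of_abs_eq_one`. -/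
theorem compl_pinchedAnnulus : pinchedAnnulusᶜ =
    {p : ℝ² | (1 ≤ |p 1| ∧ (‖p‖ ≤ 3 ∨ 4 ≤ ‖p‖)) ∨ (|p 1| ≤ 1 ∧ 𝐤 * |p 1| ≤ |(|p 0| - 𝐦)|)} := by
  ext p
  rw [mem_compl_iff, mem_pinchedAnnulus_iff, mem_ofPred_eq]
  rcases lt_trichotomy |p 1| 1 with h | h | h
  · simp only [not_le.2 h, h, h.le, false_and, true_and, false_or, not_lt]
  · obtain ⟨e1, -, -, e4⟩ := norm_iff_of_abs_eq_one p h
    have h3 : ‖p‖ ≤ 3 ↔ |p 0| ≤ 𝐦 - 𝐤 := by rw [← not_lt, e1, not_lt]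
    have h4 : 4 ≤ ‖p‖ ↔ 𝐦 + 𝐤 ≤ |p 0| := by rw [← not_lt, e4, not_lt]
    rw [h, h3, h4, e1, e4, mul_one, le_abs]
    simp only [le_refl, lt_irrefl, true_and, false_and, or_false]
    grind
  · simp only [h.le, not_lt.2 h.le, not_le.2 h, true_and, false_and, or_false, not_and_or, not_lt]

theorem isOpen_pinchedAnnulus : IsOpen pinchedAnnulus := by
  have h0 : Continuous fun p : ℝ² => p 0 := by fun_prop
  have h1 : Continuous fun p : ℝ² => p 1 := by fun_prop
  rw [← isClosed_compl_iff, compl_pinchedAnnulus]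
  refine IsClosed.union ?_ ?_
  · exact (isClosed_le continuous_const h1.abs).inter ((isClosed_le continuous_norm
      continuous_const).union (isClosed_le continuous_const continuous_norm))
  · exact (isClosed_le h1.abs continuous_const).inter (isClosed_le
      (continuous_const.mul h1.abs) (h0.abs.sub continuous_const).abs)

theorem pinchedAnnulus_subset_closedPinchedAnnulus : pinchedAnnulus ⊆ closedPinchedAnnulus := by
  rintro p (⟨h1, h2, h3⟩ | ⟨h1, h2⟩)
  · exact .inl ⟨h1, h2.le, h3.le⟩
  · exact .inr ⟨h1.le, h2.le⟩

theorem closedPinchedAnnulus_diff : closedPinchedAnnulus \ pinchedAnnulus = pinchedCurve := by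
  ext p
  rw [mem_sdiff, mem_pinchedCurve_iff, mem_pinchedAnnulus_iff, closedPinchedAnnulus, mem_ofPred_eq]
  rcases lt_trichotomy |p 1| 1 with h | h | h
  · simp only [not_le.2 h, h, h.le, false_and, true_and, false_or, not_lt, le_antisymm_iff]
  · obtain ⟨e1, e2, e3, e4⟩ := norm_iff_of_abs_eq_one p h
    rw [le_antisymm_iff (a := ‖p‖), le_antisymm_iff (a := ‖p‖), le_antisymm_iff (a := |_|)]
    simp only [← not_lt, e1, e2, e3, e4, h]
    simp only [not_lt, mul_one, lt_irrefl, false_and, or_false, abs_le, le_abs]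
    grind
  · simp only [h.le, not_lt.2 h.le, not_le.2 h, true_and, false_and, or_false, not_and_or, not_lt,
      le_antisymm_iff]
    grind

theorem norm_mem_Icc_of_mem_closedPinchedAnnulus {p : ℝ²} (hp : p ∈ closedPinchedAnnulus) :
    3 ≤ ‖p‖ ∧ ‖p‖ ≤ 4 := by
  obtain ⟨⟨hm, -⟩, hk, hk'⟩ := pinch_bounds
  rcases hp with ⟨-, h⟩ | ⟨h1, h2⟩
  · exact h
  rw [← not_lt, ← not_lt (b := ‖p‖), norm_lt_iff_coord p (by norm_num),
    lt_norm_iff_coord p (by norm_num), not_lt, not_lt]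
  rw [abs_le] at h2
  have hy := abs_nonneg (p 1)
  set x := |p 0|
  set y := |p 1|
  have hmk := pinchAbscissa_mul_pinchSlope
  have hs := pinchAbscissa_sq_add_pinchSlope_sq
  have hk2 : 𝐤 ^ 2 < 0.3 := by nlinarith
  constructor
  · have h3 : (𝐦 - 𝐤 * y) ^ 2 ≤ x ^ 2 := pow_le_pow_left₀ (by nlinarith) (by linarith) 2
    -- The segment ends on the circle at `y = 1`, so `1 - y` factors out; the cofactor is positive
    -- on `[0, 1]` because `𝐤 ^ 2 < 0.3`.
    have e : (𝐦 - 𝐤 * y) ^ 2 + y ^ 2 - 9 = (1 - y) * (5 / 2 - 𝐤 ^ 2 - (𝐤 ^ 2 + 1) * y) := by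
      linear_combination hs - 2 * y * hmk
    have : 0 ≤ (1 - y) * (5 / 2 - 𝐤 ^ 2 - (𝐤 ^ 2 + 1) * y) :=
      mul_nonneg (by linarith) (by nlinarith)
    linarith
  · have h3 : x ^ 2 ≤ (𝐦 + 𝐤 * y) ^ 2 := pow_le_pow_left₀ (abs_nonneg _) (by linarith) 2
    have e : 16 - (𝐦 + 𝐤 * y) ^ 2 - y ^ 2 = (1 - y) * (7 / 2 + (𝐤 ^ 2 + 1) * (1 + y)) := by
      linear_combination -hs - 2 * y * hmk
    have : 0 ≤ (1 - y) * (7 / 2 + (𝐤 ^ 2 + 1) * (1 + y)) :=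
      mul_nonneg (by linarith) (by positivity)
    linarith

/-! ### Reflections and segments -/

/-- The reflection changing the sign of the coordinate `i`. -/
noncomputable def coordFlip (i : Fin 2) : ℝ² ≃ₗᵢ[ℝ] ℝ² :=
  LinearIsometryEquiv.piLpCongrRight 2 fun j =>
    if j = i then LinearIsometryEquiv.neg ℝ else LinearIsometryEquiv.refl ℝ ℝ

theorem coordFlip_same (i : Fin 2) (p : ℝ²) : coordFlip i p i = -p i := by
  simp [coordFlip]

theorem coordFlip_of_ne {i j : Fin 2} (h : j ≠ i) (p : ℝ²) : coordFlip i p j = p j := by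
  simp [coordFlip, h]

theorem abs_coordFlip (i j : Fin 2) (p : ℝ²) : |coordFlip i p j| = |p j| := by
  rcases eq_or_ne j i with rfl | h
  · rw [coordFlip_same, abs_neg]
  · rw [coordFlip_of_ne h]

theorem forall_of_quadrant {P : ℝ² → Prop} (hP : ∀ i p, P (coordFlip i p) → P p)
    (h : ∀ p : ℝ², 0 ≤ p 0 → 0 ≤ p 1 → P p) (p : ℝ²) : P p := by
  have h0 : ∀ p : ℝ², 0 ≤ p 0 → P p := fun p hp => by
    rcases le_total 0 (p 1) with h1 | h1
    · exact h p hp h1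
    · exact hP 1 p (h _ (by rwa [coordFlip_of_ne zero_ne_one])
        (by rw [coordFlip_same]; linarith))
  rcases le_total 0 (p 0) with h1 | h1
  · exact h0 p h1
  · exact hP 0 p (h0 _ (by rw [coordFlip_same]; linarith))

/-- All segments from `x` to a ball of radius `3 / 16` lie in `S`, except for the point `x`. -/
def HasInnerCone (S : Set ℝ²) (x : ℝ²) : Prop :=
  ∃ T : ℝ², ‖T‖ ≤ 5 ∧ ∀ z ∈ ball T (3 / 16), ∀ t : ℝ, 0 < t → t ≤ 1 → x + t • (z - x) ∈ S

theorem HasInnerCone.of_linearIsometryEquiv {S : Set ℝ²} {x : ℝ²} (L : ℝ² ≃ₗᵢ[ℝ] ℝ²)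
    (hL : ∀ p, L p ∈ S → p ∈ S) (h : HasInnerCone S (L x)) : HasInnerCone S x := by
  obtain ⟨T, hT, hz⟩ := h
  refine ⟨L.symm T, by rwa [L.symm.norm_map], fun z hzT t ht ht' => hL _ ?_⟩
  have : L z ∈ ball T (3 / 16) := by
    rw [mem_ball, ← L.symm.dist_map, L.symm_apply_apply]; exact hzT
  simpa using hz (L z) this t ht ht'

theorem HasInnerCone.mem_closure {S : Set ℝ²} {x : ℝ²} (h : HasInnerCone S x) : x ∈ closure S := by
  obtain ⟨T, -, hz⟩ := h
  have hT : Filter.Tendsto (fun t : ℝ => x + t • (T - x)) (nhdsWithin 0 (Ioi 0)) (nhds x) := by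
    have : Continuous fun t : ℝ => x + t • (T - x) := by fun_prop
    simpa using (this.tendsto 0).mono_left nhdsWithin_le_nhds
  refine mem_closure_of_tendsto hT ?_
  filter_upwards [Ioc_mem_nhdsGT (zero_lt_one' ℝ)] with t ht
  exact hz T (mem_ball_self (by norm_num)) t ht.1 ht.2

/-! ### Cones at boundary points, closure, frontier and corkscrews. -/

theorem coordFlip_mem_pinchedAnnulus {i : Fin 2} {p : ℝ²} :
    coordFlip i p ∈ pinchedAnnulus ↔ p ∈ pinchedAnnulus := by
  simp only [mem_pinchedAnnulus_iff, abs_coordFlip, LinearIsometryEquiv.norm_map]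

theorem coordFlip_mem_closedPinchedAnnulus {i : Fin 2} {p : ℝ²} :
    coordFlip i p ∈ closedPinchedAnnulus ↔ p ∈ closedPinchedAnnulus := by
  simp only [closedPinchedAnnulus, mem_ofPred_eq, abs_coordFlip, LinearIsometryEquiv.norm_map]

theorem coordFlip_mem_pinchedCurve {i : Fin 2} {p : ℝ²} :
    coordFlip i p ∈ pinchedCurve ↔ p ∈ pinchedCurve := by
  simp only [mem_pinchedCurve_iff, abs_coordFlip, LinearIsometryEquiv.norm_map]

theorem coord_add_smul_sub (x z : ℝ²) (t : ℝ) (i : Fin 2) :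
    (x + t • (z - x)) i = (1 - t) * x i + t * z i := by
  simp; ring

theorem abs_coord_sub_lt {z T : ℝ²} {c : ℝ} (h : z ∈ ball T c) (i : Fin 2) : |z i - T i| < c := by
  rw [mem_ball, dist_eq_norm] at h
  exact (abs_coord_le_norm (z - T) i).trans_lt h

theorem add_smul_sub_mem_ball {x z T : ℝ²} {r t : ℝ} (hx : x ∈ closedBall T r) (hz : z ∈ ball T r)
    (ht : 0 < t) (ht' : t ≤ 1) : x + t • (z - x) ∈ ball T r := by
  rw [mem_ball, dist_eq_norm] at *
  rw [mem_closedBall, dist_eq_norm] at hx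
  have e : x + t • (z - x) - T = (1 - t) • (x - T) + t • (z - T) := by module
  rw [e]
  refine (norm_add_le _ _).trans_lt ?_
  rw [norm_smul, norm_smul, Real.norm_of_nonneg ht.le, Real.norm_of_nonneg (by linarith)]
  nlinarith [mul_le_mul_of_nonneg_left hx (by linarith : 0 ≤ 1 - t)]

theorem hasInnerCone_pinchedAnnulus {x : ℝ²} (hx : x ∈ pinchedCurve) :
    HasInnerCone pinchedAnnulus x := by
  obtain ⟨⟨hm, hm'⟩, hk, hk'⟩ := pinch_bounds
  revert hx
  refine forall_of_quadrant (P := fun x => x ∈ pinchedCurve → HasInnerCone pinchedAnnulus x)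
    (fun i p h hp => (h (coordFlip_mem_pinchedCurve.2 hp)).of_linearIsometryEquiv _
      fun _ => coordFlip_mem_pinchedAnnulus.1) (fun x h0 h1 hx => ?_) x
  rw [mem_pinchedCurve_iff, abs_of_nonneg h0, abs_of_nonneg h1] at hx
  rcases hx with ⟨hx1, hxn⟩ | ⟨hx1, hx0⟩
  · have hn : 3 ≤ ‖x‖ ∧ ‖x‖ ≤ 4 := by rcases hxn with h | h <;> norm_num [h]
    have hn0 : 0 < ‖x‖ := by linarith
    -- Radial projection to the middle circle: `x` is at distance `1/2` from `A`, and `B(A,1/2)`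
    -- lies in the annulus.
    set A : ℝ² := (7 / 2 / ‖x‖) • x with hA
    have hAn : ‖A‖ = 7 / 2 := by
      rw [hA, norm_smul, Real.norm_of_nonneg (by positivity), div_mul_cancel₀ _ hn0.ne']
    have hA1 : 7 / 8 ≤ A 1 := by
      rw [hA, PiLp.smul_apply, smul_eq_mul]
      have : 7 / 8 ≤ 7 / 2 / ‖x‖ := by rw [le_div_iff₀ hn0]; linarith
      nlinarith
    have hxA : x ∈ closedBall A (1 / 2) := by
      have e : x - A = (1 - 7 / 2 / ‖x‖) • x := by rw [hA]; module
      rw [mem_closedBall, dist_eq_norm, e, norm_smul, Real.norm_eq_abs]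
      rcases hxn with h | h <;> rw [h] <;> norm_num [abs_of_nonneg, abs_of_neg]
    -- Raising `A` by `5/16` keeps the target ball in `B(A,1/2)`, as `5/16 + 3/16 = 1/2`, and above
    -- height one, as `7/8 + 5/16 - 3/16 = 1`.
    set v : ℝ² := !₂[0, 5 / 16] with hv
    have hvn : ‖v‖ ≤ 5 / 16 := by
      refine (norm_le_abs_add_abs v).trans ?_
      norm_num [hv, abs_of_pos]
    refine ⟨A + v, by linarith [norm_add_le A v], fun z hz t ht ht' => ?_⟩
    have hz1 := (abs_lt.1 (abs_coord_sub_lt hz 1)).1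
    have hv1 : v 1 = 5 / 16 := by simp [hv]
    rw [PiLp.add_apply, hv1] at hz1
    have hp1 : 1 ≤ (x + t • (z - x)) 1 := by
      rw [coord_add_smul_sub]; nlinarith
    have hzA : z ∈ ball A (1 / 2) := by
      refine ball_subset_ball' ?_ hz
      rw [dist_eq_norm, add_sub_cancel_left]; linarith
    have hp := add_smul_sub_mem_ball hxA hzA ht ht'
    rw [mem_ball, dist_eq_norm] at hp
    have := abs_lt.1 ((abs_norm_sub_norm_le _ _).trans_lt hp)
    rw [hAn] at this
    exact .inl ⟨hp1.trans (le_abs_self _), by linarith, by linarith⟩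
  -- The target ball lies in the open triangle `|x - 𝐦| < 𝐤 y`, `y < 1`, whose closure is convex and
  -- contains the boundary point.
  · refine ⟨!₂[𝐦, 3 / 4], (norm_le_abs_add_abs _).trans ?_, fun z hz t ht ht' => (mem_pinchedAnnulus_iff _).2 (.inr ?_)⟩
    · simp only [Matrix.cons_val_zero, Matrix.cons_val_one]
      rw [abs_of_pos, abs_of_pos] <;> linarith
    have hz0 := abs_lt.1 (abs_coord_sub_lt hz 0)
    have hz1 := abs_lt.1 (abs_coord_sub_lt hz 1)
    simp only [Matrix.cons_val_zero, Matrix.cons_val_one] at hz0 hz1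
    rw [coord_add_smul_sub, coord_add_smul_sub]
    obtain ⟨hx0', hx0''⟩ := abs_le.1 hx0.le
    have i1 : 0 ≤ (1 - t) * (x 0 - 𝐦 + 𝐤 * x 1) := mul_nonneg (by linarith) (by linarith)
    have i2 : 0 ≤ (1 - t) * (𝐤 * x 1 - (x 0 - 𝐦)) := mul_nonneg (by linarith) (by linarith)
    have i3 : 0 < t * (z 0 - 𝐦 + 𝐤 * z 1) := mul_pos ht (by nlinarith)
    have i4 : 0 < t * (𝐤 * z 1 - (z 0 - 𝐦)) := mul_pos ht (by nlinarith)
    have i5 : 0 ≤ (1 - t) * x 0 := mul_nonneg (by linarith) h0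
    have i6 : 0 ≤ (1 - t) * x 1 := mul_nonneg (by linarith) h1
    have i7 : 0 < t * z 0 := mul_pos ht (by linarith)
    have i8 : 0 < t * z 1 := mul_pos ht (by linarith)
    have i9 : 0 ≤ (1 - t) * (1 - x 1) := mul_nonneg (by linarith) (by linarith)
    have i10 : 0 < t * (1 - z 1) := mul_pos ht (by linarith)
    have e0 : |(1 - t) * x 0 + t * z 0| = (1 - t) * x 0 + t * z 0 := abs_of_pos (by linarith)
    have e1 : |(1 - t) * x 1 + t * z 1| = (1 - t) * x 1 + t * z 1 := abs_of_pos (by linarith)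
    rw [e0, e1, abs_lt]
    refine ⟨by linarith, by linarith, by linarith⟩

theorem closure_pinchedAnnulus : closure pinchedAnnulus = closedPinchedAnnulus := by
  refine (closure_minimal pinchedAnnulus_subset_closedPinchedAnnulus
    isClosed_closedPinchedAnnulus).antisymm fun p hp => ?_
  by_cases h : p ∈ pinchedAnnulus
  · exact subset_closure h
  · refine (hasInnerCone_pinchedAnnulus ?_).mem_closure
    rw [← closedPinchedAnnulus_diff]
    exact ⟨hp, h⟩

theorem frontier_pinchedAnnulus : frontier pinchedAnnulus = pinchedCurve := by
  rw [isOpen_pinchedAnnulus.frontier_eq, closure_pinchedAnnulus, closedPinchedAnnulus_diff]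

theorem interior_compl_pinchedAnnulus : interior pinchedAnnulusᶜ = closedPinchedAnnulusᶜ := by
  rw [interior_compl, closure_pinchedAnnulus]

theorem norm_le_of_mem_pinchedCurve {p : ℝ²} (hp : p ∈ pinchedCurve) : ‖p‖ ≤ 4 := by
  rw [← closedPinchedAnnulus_diff] at hp
  exact (norm_mem_Icc_of_mem_closedPinchedAnnulus hp.1).2

theorem hasInnerCone_compl_closedPinchedAnnulus {x : ℝ²} (hx : x ∈ pinchedCurve) :
    HasInnerCone closedPinchedAnnulusᶜ x := by
  obtain ⟨⟨hm, hm'⟩, hk, hk'⟩ := pinch_bounds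
  revert hx
  refine forall_of_quadrant (P := fun x => x ∈ pinchedCurve → HasInnerCone closedPinchedAnnulusᶜ x)
    (fun i p h hp => (h (coordFlip_mem_pinchedCurve.2 hp)).of_linearIsometryEquiv _
      fun _ => mt coordFlip_mem_closedPinchedAnnulus.2) (fun x h0 h1 hx => ?_) x
  rw [mem_pinchedCurve_iff, abs_of_nonneg h0, abs_of_nonneg h1] at hx
  rcases hx with ⟨hx1, hxn | hxn⟩ | ⟨hx1, hx0⟩
  -- Segments from the inner circle towards the centre stay in the open disc of radius `3`.
  · refine ⟨0, by simp, fun z hz t ht ht' hp => ?_⟩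
    have := add_smul_sub_mem_ball (x := x) (T := 0) (r := 3) (by simp [hxn])
      (ball_subset_ball (by norm_num) hz) ht ht'
    rw [mem_ball_zero_iff] at this
    linarith [(norm_mem_Icc_of_mem_closedPinchedAnnulus hp).1]
  -- The segments enter the half-plane `⟨p, x⟩ > 16`, which by Cauchy–Schwarz misses the disc of
  -- radius `4 = ‖x‖`.
  · refine ⟨(5 / 4 : ℝ) • x, by rw [norm_smul, hxn]; norm_num, fun z hz t ht ht' hp => ?_⟩
    rw [mem_ball, dist_eq_norm] at hz
    have hin : -(3 / 4) < inner ℝ (z - (5 / 4 : ℝ) • x) x := by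
      have h2 := (abs_le.1 (abs_real_inner_le_norm (z - (5 / 4 : ℝ) • x) x)).1
      rw [hxn] at h2
      linarith
    have hxx : inner ℝ x x = (16 : ℝ) := by rw [real_inner_self_eq_norm_sq, hxn]; norm_num
    rw [inner_sub_left, real_inner_smul_left, hxx] at hin
    have h3 := (norm_mem_Icc_of_mem_closedPinchedAnnulus hp).2
    have h4 := real_inner_le_norm (x + t • (z - x)) x
    rw [inner_add_left, real_inner_smul_left, inner_sub_left, hxx, hxn] at h4
    nlinarith
  · rw [abs_eq (by nlinarith)] at hx0
    have key : ∀ p : ℝ², |p 1| < 1 → 𝐤 * |p 1| < |(|p 0| - 𝐦)| → p ∉ closedPinchedAnnulus := by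
      rintro p h1 h2 (⟨h3, -⟩ | ⟨-, h3⟩) <;> linarith
    have hk1 : |x 1| = x 1 := abs_of_nonneg h1
    rcases hx0 with hx0 | hx0
    -- An outer segment: the exterior contains the wedge `x - 𝐦 > 𝐤 |y|`, `|y| < 1`, to the right of
    -- the pinch.
    · refine ⟨!₂[𝐦 + 1, 0], (norm_le_abs_add_abs _).trans ?_, fun z hz t ht ht' => key _ ?_ ?_⟩
      · simp only [Matrix.cons_val_zero, Matrix.cons_val_one]
        rw [abs_of_pos, abs_zero] <;> linarith
      all_goals
        have hz0 := (abs_lt.1 (abs_coord_sub_lt hz 0)).1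
        have hz1 := abs_coord_sub_lt hz 1
        simp only [Matrix.cons_val_zero, Matrix.cons_val_one, sub_zero] at hz0 hz1
        rw [coord_add_smul_sub]
        have a1 : |(1 - t) * x 1 + t * z 1| ≤ (1 - t) * x 1 + t * |z 1| := by
          refine (abs_add_le _ _).trans ?_
          rw [abs_mul, abs_mul, hk1, abs_of_pos ht, abs_of_nonneg (by linarith)]
      · refine a1.trans_lt ?_
        nlinarith
      · rw [coord_add_smul_sub]
        have i1 : 0 < t * (z 0 - 𝐦 - 𝐤 * |z 1|) := mul_pos ht (by nlinarith)
        have i2 := mul_le_mul_of_nonneg_left a1 (by linarith : 0 ≤ 𝐤)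
        refine lt_of_lt_of_le ?_ ((sub_le_sub_right (le_abs_self _) _).trans (le_abs_self _))
        have e : (1 - t) * x 0 = (1 - t) * (𝐦 + 𝐤 * x 1) := by
          rw [show x 0 = 𝐦 + 𝐤 * x 1 by linarith]
        rw [e]
        linarith
    -- An inner segment: the exterior contains the convex set `|x| + 𝐤 |y| < 𝐦`, `|y| < 1`.
    · refine ⟨0, by simp, fun z hz t ht ht' => key _ ?_ ?_⟩
      all_goals
        have hz0 := abs_coord_sub_lt hz 0
        have hz1 := abs_coord_sub_lt hz 1
        simp only [PiLp.zero_apply, sub_zero] at hz0 hz1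
        rw [coord_add_smul_sub]
        have a1 : |(1 - t) * x 1 + t * z 1| ≤ (1 - t) * x 1 + t * |z 1| := by
          refine (abs_add_le _ _).trans ?_
          rw [abs_mul, abs_mul, hk1, abs_of_pos ht, abs_of_nonneg (by linarith)]
      · refine a1.trans_lt ?_
        nlinarith
      · rw [coord_add_smul_sub]
        have a0 : |(1 - t) * x 0 + t * z 0| ≤ (1 - t) * x 0 + t * |z 0| := by
          refine (abs_add_le _ _).trans ?_
          rw [abs_mul, abs_mul, abs_of_nonneg h0, abs_of_pos ht, abs_of_nonneg (by linarith)]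
        have i1 : 0 < t * (𝐦 - |z 0| - 𝐤 * |z 1|) := mul_pos ht (by nlinarith)
        have i2 := mul_le_mul_of_nonneg_left a1 (by linarith : 0 ≤ 𝐤)
        refine lt_of_lt_of_le ?_ (neg_le_abs _)
        have e : (1 - t) * x 0 = (1 - t) * (𝐦 - 𝐤 * x 1) := by
          rw [show x 0 = 𝐦 - 𝐤 * x 1 by linarith]
        linarith

theorem isBounded_pinchedAnnulus : Bornology.IsBounded pinchedAnnulus :=
  (isBounded_closedBall (x := (0 : ℝ²)) (r := 4)).subset fun p hp => by
    rw [mem_closedBall_zero_iff]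
    exact (norm_mem_Icc_of_mem_closedPinchedAnnulus
      (pinchedAnnulus_subset_closedPinchedAnnulus hp)).2

theorem twoSided_corkscrew_pinchedAnnulus : TwoSided Corkscrew pinchedAnnulus := by
  constructor
  · refine corkscrew_of_segments (c := 3 / 16) (R := 5) (by norm_num) (by norm_num) ?_ ?_
    · rw [frontier_pinchedAnnulus]
      exact fun x hx => (norm_le_of_mem_pinchedCurve hx).trans (by norm_num)
    · rw [frontier_pinchedAnnulus]
      exact fun x hx => hasInnerCone_pinchedAnnulus hx
  · have hsub : frontier (interior pinchedAnnulusᶜ) ⊆ pinchedCurve := by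
      rw [← frontier_pinchedAnnulus, ← frontier_compl pinchedAnnulus]
      exact frontier_interior_subset
    refine corkscrew_of_segments (c := 3 / 16) (R := 5) (by norm_num) (by norm_num)
      (fun x hx => (norm_le_of_mem_pinchedCurve (hsub hx)).trans (by norm_num)) fun x hx => ?_
    rw [interior_compl_pinchedAnnulus]
    exact hasInnerCone_compl_closedPinchedAnnulus (hsub hx)

/-! ### Disconnectedness and failure of the chord-arc condition. -/

theorem not_isPreconnected_pinchedAnnulus : ¬ IsPreconnected pinchedAnnulus := by
  intro h
  have hmem : ∀ y : ℝ, |y| = 7 / 2 → (!₂[0, y] : ℝ²) ∈ pinchedAnnulus := fun y hy => by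
    have hn : ‖(!₂[0, y] : ℝ²)‖ = 7 / 2 := by
      rw [← hy, EuclideanSpace.norm_eq]
      simp [Real.sqrt_sq_eq_abs]
    refine .inl ⟨?_, ?_, ?_⟩
    · simp [hy]; norm_num
    · rw [hn]; norm_num
    · rw [hn]; norm_num
  have h1 : Continuous fun p : ℝ² => p 1 := by fun_prop
  obtain ⟨p, hp, hp0⟩ := h.intermediate_value (hmem (-(7 / 2)) (by norm_num [abs_of_pos]))
    (hmem (7 / 2) (by norm_num [abs_of_pos])) h1.continuousOn
    (show (0 : ℝ) ∈ Icc _ _ by constructor <;> simp <;> norm_num)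
  simp only at hp0
  rw [mem_pinchedAnnulus_iff, hp0, abs_zero, mul_zero] at hp
  rcases hp with ⟨hp, -⟩ | ⟨-, hp⟩
  · linarith
  · linarith [abs_nonneg (|p 0| - 𝐦)]

theorem not_isCAD_pinchedAnnulus : ¬ IsCAD 1 pinchedAnnulus := fun h =>
  not_isPreconnected_pinchedAnnulus (h.isNTA.harnackChain.isPreconnected isOpen_pinchedAnnulus)

/-! ### Bi-Lipschitz arcs and gauges -/

/-- A bi-Lipschitz image of the interval `[-1, 1]`. -/
def IsBilipschitzArc {X : Type*} [MetricSpace X] (K K' : NNReal) (A : Set X) : Prop :=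
  ∃ φ : ℝ → X, LipschitzOnWith K φ (Icc (-1) 1) ∧
    (∀ s ∈ Icc (-1 : ℝ) 1, ∀ t ∈ Icc (-1 : ℝ) 1, dist s t ≤ K' * dist (φ s) (φ t)) ∧
    φ '' Icc (-1) 1 = A

namespace IsBilipschitzArc

variable {X : Type*} [MetricSpace X] {K K' : NNReal} {A : Set X}

theorem isPreconnected (h : IsBilipschitzArc K K' A) : IsPreconnected A := by
  obtain ⟨φ, h1, -, rfl⟩ := h
  exact isPreconnected_Icc.image _ h1.continuousOn

theorem hausdorffMeasure_ball_inter_le [MeasurableSpace X] [BorelSpace X]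
    (h : IsBilipschitzArc K K' A) (x : X) (r : ℝ) :
    μH[1] (ball x r ∩ A) ≤ ENNReal.ofReal (2 * K * K' * r) := by
  obtain ⟨φ, h1, h2, rfl⟩ := h
  exact hausdorffMeasure_ball_inter_image_le h1 h2 x r

theorem image_isometry {Y : Type*} [MetricSpace Y] (h : IsBilipschitzArc K K' A) {L : X → Y}
    (hL : Isometry L) : IsBilipschitzArc K K' (L '' A) := by
  obtain ⟨φ, h1, h2, rfl⟩ := h
  refine ⟨L ∘ φ, ?_, fun s hs t ht => ?_, image_comp _ _ _⟩
  · simpa using hL.lipschitz.comp_lipschitzOnWith h1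
  · rw [Function.comp_apply, Function.comp_apply, hL.dist_eq]
    exact h2 s hs t ht

theorem exists_isChordArcPath (h : IsBilipschitzArc K K' A) {E : Set X} (hAE : A ⊆ E) {x y : E}
    (hx : (x : X) ∈ A) (hy : (y : X) ∈ A) : ∃ γ : Path x y, IsChordArcPath (K * K') γ := by
  classical
  obtain ⟨φ, h1, h2, rfl⟩ := h
  -- Corestriction of `φ` to `E`; the default value `x` never occurs on `[-1, 1]`.
  let ψ : ℝ → E := fun s => if h : φ s ∈ E then ⟨φ s, h⟩ else x
  have hψ : ∀ s ∈ Icc (-1 : ℝ) 1, (ψ s : X) = φ s := fun s hs => by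
    simp only [ψ, dif_pos (hAE (mem_image_of_mem φ hs))]
  obtain ⟨s, hs, hsx⟩ := hx
  obtain ⟨t, ht, hty⟩ := hy
  have hx : ψ s = x := Subtype.ext ((hψ s hs).trans hsx)
  have hy : ψ t = y := Subtype.ext ((hψ t ht).trans hty)
  suffices ∃ γ : Path (ψ s) (ψ t), IsChordArcPath (K * K') γ by rwa [hx, hy] at this
  refine exists_isChordArcPath_of_bilipschitz (convex_Icc _ _) ?_ ?_ hs ht
  · refine LipschitzOnWith.of_dist_le_mul fun s hs t ht => ?_
    rw [Subtype.dist_eq, hψ s hs, hψ t ht]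
    exact h1.dist_le_mul s hs t ht
  · intro s hs t ht
    rw [Subtype.dist_eq, hψ s hs, hψ t ht]
    exact h2 s hs t ht

end IsBilipschitzArc

/-- A positively homogeneous function on the plane, comparable to the norm. -/
structure IsPlaneGauge (G : ℝ² → ℝ) : Prop where
  abs_sub_le : ∀ p q, |G p - G q| ≤ ‖p - q‖
  map_smul : ∀ (t : ℝ) (p : ℝ²), 0 ≤ t → G (t • p) = t * G p
  norm_le : ∀ p, ‖p‖ ≤ 8 * G p

/-- The parametrization of the upper half of the unit sphere of the `ℓ¹` norm. -/
noncomputable def diamondParam (u : ℝ) : ℝ² := !₂[u, 1 - |u|]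

@[simp] theorem diamondParam_zero (u : ℝ) : diamondParam u 0 = u := by simp [diamondParam]

@[simp] theorem diamondParam_one (u : ℝ) : diamondParam u 1 = 1 - |u| := by simp [diamondParam]

theorem abs_diamondParam_add {u : ℝ} (hu : u ∈ Icc (-1 : ℝ) 1) :
    |diamondParam u 0| + |diamondParam u 1| = 1 := by
  rw [diamondParam_zero, diamondParam_one, abs_of_nonneg (a := 1 - |u|)
    (by linarith [abs_le.2 hu])]
  ring

theorem norm_diamondParam_sub_le (u v : ℝ) : ‖diamondParam u - diamondParam v‖ ≤ 2 * |u - v| := by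
  refine (norm_le_abs_add_abs _).trans ?_
  rw [PiLp.sub_apply, PiLp.sub_apply, diamondParam_zero, diamondParam_one, diamondParam_zero,
    diamondParam_one, show 1 - |u| - (1 - |v|) = |v| - |u| by ring, abs_sub_comm |v|]
  linarith [abs_abs_sub_abs_le_abs_sub u v]

/-- The parametrization of the upper half of the unit sphere of a gauge. -/
noncomputable def gaugeParam (G : ℝ² → ℝ) (u : ℝ) : ℝ² := (G (diamondParam u))⁻¹ • diamondParam u

namespace IsPlaneGauge

variable {G : ℝ² → ℝ}

theorem map_zero (hG : IsPlaneGauge G) : G 0 = 0 := by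
  simpa using hG.map_smul 0 0 le_rfl

theorem le_norm (hG : IsPlaneGauge G) (p : ℝ²) : G p ≤ ‖p‖ := by
  have := hG.abs_sub_le p 0
  rw [hG.map_zero, sub_zero, sub_zero] at this
  exact (le_abs_self _).trans this

theorem diamondParam_bounds (hG : IsPlaneGauge G) {u : ℝ} (hu : u ∈ Icc (-1 : ℝ) 1) :
    1 / 16 ≤ G (diamondParam u) ∧ G (diamondParam u) ≤ 1 := by
  have h := abs_diamondParam_add hu
  constructor
  · linarith [hG.norm_le (diamondParam u), abs_coord_le_norm (diamondParam u) 0,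
      abs_coord_le_norm (diamondParam u) 1]
  · linarith [hG.le_norm (diamondParam u), norm_le_abs_add_abs (diamondParam u)]

/-- On the `ℓ¹` sphere `G ≥ 1/16`, so `1 / G` is bounded by `16` and varies by at most `16 * 16 * 2
|u - v|`; the product rule gives `544 = 16 * 2 + 512`. -/
theorem lipschitzOnWith_gaugeParam (hG : IsPlaneGauge G) :
    LipschitzOnWith 544 (gaugeParam G) (Icc (-1) 1) := by
  refine LipschitzOnWith.of_dist_le_mul fun u hu v hv => ?_
  obtain ⟨hu1, -⟩ := hG.diamondParam_bounds hu
  obtain ⟨hv1, -⟩ := hG.diamondParam_bounds hv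
  have hd := norm_diamondParam_sub_le u v
  have hGd := (hG.abs_sub_le (diamondParam v) (diamondParam u)).trans_eq (norm_sub_rev _ _)
  have hvn : ‖diamondParam v‖ ≤ 1 :=
    (norm_le_abs_add_abs _).trans_eq (abs_diamondParam_add hv)
  rw [dist_eq_norm, Real.dist_eq, gaugeParam, gaugeParam]
  set a := G (diamondParam u)
  set b := G (diamondParam v)
  have ha : 0 < a := by linarith
  have hb : 0 < b := by linarith
  have ha' : a⁻¹ ≤ 16 := inv_le_of_inv_le₀ (by norm_num) (by linarith)
  have hb' : b⁻¹ ≤ 16 := inv_le_of_inv_le₀ (by norm_num) (by linarith)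
  have hab : |a⁻¹ - b⁻¹| ≤ 16 * 16 * (2 * |u - v|) := by
    rw [inv_sub_inv ha.ne' hb.ne', abs_div, abs_of_pos (mul_pos ha hb), div_eq_mul_inv, mul_inv,
      mul_comm]
    exact mul_le_mul (mul_le_mul ha' hb' (by positivity) (by norm_num)) (hGd.trans hd)
      (abs_nonneg _) (by norm_num)
  have e : a⁻¹ • diamondParam u - b⁻¹ • diamondParam v =
      a⁻¹ • (diamondParam u - diamondParam v) + (a⁻¹ - b⁻¹) • diamondParam v := by module
  rw [e]
  refine (norm_add_le _ _).trans ?_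
  rw [norm_smul, norm_smul, Real.norm_of_nonneg (by positivity), Real.norm_eq_abs]
  have h1 := mul_le_mul ha' hd (norm_nonneg _) (by norm_num)
  have h2 := mul_le_mul hab hvn (norm_nonneg _) (by positivity)
  push_cast
  linarith

/-- The inverse is `p ↦ p 0 / (|p 0| + |p 1|)`, independent of the gauge, and the denominator is at
least one because `G ≤ 1` on the `ℓ¹` sphere. -/
theorem dist_le_gaugeParam (hG : IsPlaneGauge G) {u v : ℝ} (hu : u ∈ Icc (-1 : ℝ) 1)
    (hv : v ∈ Icc (-1 : ℝ) 1) : dist u v ≤ 3 * dist (gaugeParam G u) (gaugeParam G v) := by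
  obtain ⟨hu1, hu2⟩ := hG.diamondParam_bounds hu
  obtain ⟨hv1, hv2⟩ := hG.diamondParam_bounds hv
  have hsu := abs_diamondParam_add hu
  have hsv := abs_diamondParam_add hv
  set p := gaugeParam G u with hp
  set q := gaugeParam G v with hq
  set a := G (diamondParam u)
  set b := G (diamondParam v)
  have ha : 0 < a := by linarith
  have hb : 0 < b := by linarith
  have hpu : diamondParam u = a • p := by rw [hp, gaugeParam, smul_inv_smul₀ ha.ne']
  have hqv : diamondParam v = b • q := by rw [hq, gaugeParam, smul_inv_smul₀ hb.ne']
  have hu0 : u = a * p 0 := by rw [← diamondParam_zero u, hpu]; rfl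
  have hv0 : v = b * q 0 := by rw [← diamondParam_zero v, hqv]; rfl
  have hpa : a * (|p 0| + |p 1|) = 1 := by
    rw [← hsu, hpu, PiLp.smul_apply, PiLp.smul_apply, smul_eq_mul, smul_eq_mul, abs_mul, abs_mul,
      abs_of_pos ha, mul_add]
  have hqb : b * (|q 0| + |q 1|) = 1 := by
    rw [← hsv, hqv, PiLp.smul_apply, PiLp.smul_apply, smul_eq_mul, smul_eq_mul, abs_mul, abs_mul,
      abs_of_pos hb, mul_add]
  have h0 := abs_coord_le_norm (p - q) 0
  have h1 := abs_coord_le_norm (p - q) 1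
  rw [PiLp.sub_apply] at h0 h1
  rw [Real.dist_eq, dist_eq_norm]
  -- Uses `a (|p 0| + |p 1|) = 1` and `v (|q 0| + |q 1|) = q 0`. The bracket is at most `(1 + 2) ‖p
  -- - q‖`.
  have e : u - v = a * ((p 0 - q 0) + ((|q 0| - |p 0|) + (|q 1| - |p 1|)) * v) := by
    have e1 : a * ((|q 0| + |q 1|) - (|p 0| + |p 1|)) * b = a - b := by
      linear_combination a * hqb - b * hpa
    rw [hu0, hv0]
    linear_combination -(q 0) * e1
  have hvabs : |v| ≤ 1 := abs_le.2 hv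
  have h2 : |(|q 0| - |p 0|) + (|q 1| - |p 1|)| ≤ 2 * ‖p - q‖ := by
    refine (abs_add_le _ _).trans ?_
    have := abs_abs_sub_abs_le_abs_sub (q 0) (p 0)
    have := abs_abs_sub_abs_le_abs_sub (q 1) (p 1)
    rw [abs_sub_comm (q 0)] at *
    rw [abs_sub_comm (q 1)] at *
    linarith
  have h3 : |p 0 - q 0 + ((|q 0| - |p 0|) + (|q 1| - |p 1|)) * v| ≤ 3 * ‖p - q‖ := by
    refine (abs_add_le _ _).trans ?_
    rw [abs_mul]
    have := mul_le_mul h2 hvabs (abs_nonneg _) (by positivity)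
    linarith
  rw [e, abs_mul, abs_of_pos ha]
  have := mul_le_mul hu2 h3 (abs_nonneg _) (by norm_num)
  linarith

theorem image_gaugeParam (hG : IsPlaneGauge G) :
    gaugeParam G '' Icc (-1) 1 = {p | 0 ≤ p 1 ∧ G p = 1} := by
  ext p
  constructor
  · rintro ⟨u, hu, rfl⟩
    obtain ⟨hu1, -⟩ := hG.diamondParam_bounds hu
    have ha : 0 < G (diamondParam u) := by linarith
    refine ⟨?_, ?_⟩
    · rw [gaugeParam, PiLp.smul_apply, diamondParam_one, smul_eq_mul]
      exact mul_nonneg (inv_nonneg.2 ha.le) (by linarith [abs_le.2 hu])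
    · rw [gaugeParam, hG.map_smul _ _ (inv_nonneg.2 ha.le), inv_mul_cancel₀ ha.ne']
  · rintro ⟨h1, hp⟩
    set N := |p 0| + |p 1|
    have hN : 0 < N := by linarith [hG.le_norm p, norm_le_abs_add_abs p]
    have hu : |p 0 / N| = |p 0| / N := by rw [abs_div, abs_of_pos hN]
    have hd : diamondParam (p 0 / N) = N⁻¹ • p := by
      ext i
      fin_cases i
      · simp [div_eq_inv_mul]
      · simp only [Fin.mk_one, diamondParam_one, PiLp.smul_apply, smul_eq_mul]
        rw [hu, ← abs_of_nonneg h1, ← mul_right_inj' hN.ne', mul_inv_cancel_left₀ hN.ne', mul_sub,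
          mul_div_cancel₀ _ hN.ne', mul_one]
        simp [N]
    refine ⟨p 0 / N, abs_le.1 ?_, ?_⟩
    · rw [hu, div_le_one hN]
      linarith [abs_nonneg (p 1), show N = |p 0| + |p 1| from rfl]
    · rw [gaugeParam, hd, hG.map_smul _ _ (inv_nonneg.2 hN.le), hp, mul_one, inv_inv,
        smul_inv_smul₀ hN.ne']

theorem isBilipschitzArc_upper (hG : IsPlaneGauge G) :
    IsBilipschitzArc 544 3 {p | 0 ≤ p 1 ∧ G p = 1} :=
  ⟨gaugeParam G, hG.lipschitzOnWith_gaugeParam,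
    fun _ hs _ ht => by simpa using hG.dist_le_gaugeParam hs ht, hG.image_gaugeParam⟩

theorem isBilipschitzArc_lower (hG : IsPlaneGauge G) (hflip : ∀ p, G (coordFlip 1 p) = G p) :
    IsBilipschitzArc 544 3 {p | p 1 ≤ 0 ∧ G p = 1} := by
  have h := hG.isBilipschitzArc_upper.image_isometry (coordFlip 1).isometry
  rw [LinearIsometryEquiv.image_eq_preimage_symm] at h
  convert h using 1
  ext p
  obtain ⟨q, rfl⟩ := (coordFlip 1).surjective p
  simp [hflip, coordFlip_same]

end IsPlaneGauge

/-! ### The four arcs of the pinched curve -/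

/-- The gauge whose unit sphere in the upper half-plane is the outer part of the pinched curve. -/
noncomputable def outerGauge (p : ℝ²) : ℝ := max (‖p‖ / 4) ((|p 0| - 𝐤 * |p 1|) / 𝐦)

/-- The gauge whose unit sphere in the upper half-plane is the inner part of the pinched curve. -/
noncomputable def innerGauge (p : ℝ²) : ℝ :=
  min (‖p‖ / 3) ((|p 0| + 𝐤 * |p 1|) / 𝐦 + max 0 (|p 1| - |p 0| / (𝐦 - 𝐤)) / 3)

theorem abs_abs_coord_sub_le (p q : ℝ²) (i : Fin 2) : |(|p i| - |q i|)| ≤ ‖p - q‖ :=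
  (abs_abs_sub_abs_le_abs_sub _ _).trans (abs_coord_le_norm (p - q) i)

theorem isPlaneGauge_outerGauge : IsPlaneGauge outerGauge := by
  obtain ⟨⟨hm, hm'⟩, hk, hk'⟩ := pinch_bounds
  refine ⟨fun p q => ?_, fun t p ht => ?_, fun p => ?_⟩
  · refine (abs_max_sub_max_le_max _ _ _ _).trans (max_le ?_ ?_)
    · rw [← sub_div, abs_div, abs_of_pos (four_pos : (0 : ℝ) < 4)]
      linarith [abs_norm_sub_norm_le p q, norm_nonneg (p - q)]
    · have h0 := abs_le.1 (abs_abs_coord_sub_le p q 0)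
      have h1 := abs_le.1 (abs_abs_coord_sub_le p q 1)
      rw [← sub_div, abs_div, abs_of_pos (by linarith : 0 < 𝐦), div_le_iff₀ (by linarith), abs_le]
      constructor <;> nlinarith [norm_nonneg (p - q)]
  · rw [outerGauge, outerGauge, norm_smul, PiLp.smul_apply, PiLp.smul_apply, smul_eq_mul,
      smul_eq_mul, abs_mul, abs_mul, Real.norm_of_nonneg ht, abs_of_nonneg ht,
      mul_max_of_nonneg _ _ ht]
    congr 1
    all_goals ring
  · linarith [le_max_left (‖p‖ / 4) ((|p 0| - 𝐤 * |p 1|) / 𝐦), norm_nonneg p,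
      show outerGauge p = max (‖p‖ / 4) ((|p 0| - 𝐤 * |p 1|) / 𝐦) from rfl]

theorem isPlaneGauge_innerGauge : IsPlaneGauge innerGauge := by
  obtain ⟨⟨hm, hm'⟩, hk, hk'⟩ := pinch_bounds
  refine ⟨fun p q => ?_, fun t p ht => ?_, fun p => ?_⟩
  · refine (abs_min_sub_min_le_max _ _ _ _).trans (max_le ?_ ?_)
    · rw [← sub_div, abs_div, abs_of_pos (three_pos : (0 : ℝ) < 3)]
      linarith [abs_norm_sub_norm_le p q, norm_nonneg (p - q)]
    · have hp := norm_nonneg (p - q)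
      have h0 := abs_le.1 (abs_abs_coord_sub_le p q 0)
      have h1 := abs_le.1 (abs_abs_coord_sub_le p q 1)
      -- The Lipschitz constant one is split as `1/2` for this linear term and `(1 + 1/2) / 3` for
      -- the correction.
      have i1 : |(|p 0| + 𝐤 * |p 1|) / 𝐦 - (|q 0| + 𝐤 * |q 1|) / 𝐦| ≤ 1 / 2 * ‖p - q‖ := by
        rw [← sub_div, abs_div, abs_of_pos (by linarith : 0 < 𝐦), div_le_iff₀ (by linarith), abs_le]
        constructor <;> nlinarith
      have i2 : |(|p 0| / (𝐦 - 𝐤) - |q 0| / (𝐦 - 𝐤))| ≤ 1 / 2 * ‖p - q‖ := by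
        rw [← sub_div, abs_div, abs_of_pos (by linarith : 0 < 𝐦 - 𝐤), div_le_iff₀ (by linarith),
          abs_le]
        constructor <;> nlinarith
      have i3 : |max 0 (|p 1| - |p 0| / (𝐦 - 𝐤)) - max 0 (|q 1| - |q 0| / (𝐦 - 𝐤))| ≤
          3 / 2 * ‖p - q‖ := by
        refine (abs_max_sub_max_le_max _ _ _ _).trans (max_le ?_ ?_)
        · rw [sub_zero, abs_zero]; positivity
        · rw [abs_le] at i2 ⊢
          constructor <;> linarith
      rw [abs_le] at *
      constructor <;> linarith
  · rw [innerGauge, innerGauge, norm_smul, PiLp.smul_apply, PiLp.smul_apply, smul_eq_mul,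
      smul_eq_mul, abs_mul, abs_mul, Real.norm_of_nonneg ht, abs_of_nonneg ht,
      mul_min_of_nonneg _ _ ht]
    congr 1
    · ring
    · have : max 0 (t * |p 1| - t * |p 0| / (𝐦 - 𝐤)) = t * max 0 (|p 1| - |p 0| / (𝐦 - 𝐤)) := by
        rw [mul_max_of_nonneg _ _ ht, mul_zero]
        congr 1
        ring
      rw [this]
      ring
  · have hn := norm_nonneg p
    have h1 : ‖p‖ / 8 ≤ (|p 0| + 𝐤 * |p 1|) / 𝐦 := by
      rw [div_le_div_iff₀ (by norm_num) (by linarith)]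
      nlinarith [norm_le_abs_add_abs p, abs_nonneg (p 0), abs_nonneg (p 1)]
    have h2 : ‖p‖ / 8 ≤ innerGauge p :=
      le_min (by linarith) (by linarith [le_max_left 0 (|p 1| - |p 0| / (𝐦 - 𝐤))])
    linarith

theorem outerGauge_coordFlip (i : Fin 2) (p : ℝ²) : outerGauge (coordFlip i p) = outerGauge p := by
  simp only [outerGauge, abs_coordFlip, LinearIsometryEquiv.norm_map]

theorem innerGauge_coordFlip (i : Fin 2) (p : ℝ²) : innerGauge (coordFlip i p) = innerGauge p := by
  simp only [innerGauge, abs_coordFlip, LinearIsometryEquiv.norm_map]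

/-- The outer segments lie inside the disc of radius `4`, so the enclosed region is the disc cut by
`|x| - 𝐤 |y| ≤ 𝐦`: a maximum of gauges. The two boundaries cross at height one. -/
theorem outerGauge_eq_one_iff (p : ℝ²) : outerGauge p = 1 ↔
    (1 ≤ |p 1| ∧ ‖p‖ = 4) ∨ (|p 1| ≤ 1 ∧ |p 0| = 𝐦 + 𝐤 * |p 1|) := by
  obtain ⟨⟨hm, hm'⟩, hk, hk'⟩ := pinch_bounds
  have hsq : |p 0| ^ 2 + |p 1| ^ 2 = ‖p‖ ^ 2 := by rw [norm_sq_eq_coord, sq_abs, sq_abs]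
  have h0 := abs_nonneg (p 0)
  have h1 := abs_nonneg (p 1)
  have hab := pinchAbscissa_add_sq
  have hn := norm_nonneg p
  have hm0 : 0 < 𝐦 := by linarith
  rw [outerGauge]
  constructor
  · intro h
    have hA : ‖p‖ ≤ 4 := by linarith [le_max_left (‖p‖ / 4) ((|p 0| - 𝐤 * |p 1|) / 𝐦)]
    have hB : |p 0| - 𝐤 * |p 1| ≤ 𝐦 := by
      have := (le_max_right (‖p‖ / 4) ((|p 0| - 𝐤 * |p 1|) / 𝐦)).trans_eq h
      rwa [div_le_one hm0] at this
    rcases max_choice (‖p‖ / 4) ((|p 0| - 𝐤 * |p 1|) / 𝐦) with e | e <;> rw [h] at e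
    · have hp : ‖p‖ = 4 := by linarith
      refine .inl ⟨not_lt.1 fun hlt => ?_, hp⟩
      have : 𝐦 + 𝐤 < |p 0| := lt_of_pow_lt_pow_left₀ 2 h0 (by rw [hp] at hsq; nlinarith)
      nlinarith
    · rw [eq_comm, div_eq_one_iff_eq hm0.ne'] at e
      refine .inr ⟨not_lt.1 fun hlt => ?_, by linarith⟩
      have h2 : (𝐦 + 𝐤) ^ 2 < |p 0| ^ 2 := by
        apply pow_lt_pow_left₀ _ (by linarith) two_ne_zero
        nlinarith
      nlinarith
  · rintro (⟨h2, h3⟩ | ⟨h2, h3⟩)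
    · have : |p 0| ≤ 𝐦 + 𝐤 := (abs_le_of_sq_le_sq' (by nlinarith) (by linarith)).2
      rw [h3, max_eq_left] <;> norm_num
      rw [div_le_one hm0]
      nlinarith
    · have hmem : p ∈ closedPinchedAnnulus := .inr ⟨h2, by
        rw [h3, add_sub_cancel_left, abs_of_nonneg (by nlinarith)]⟩
      have := (norm_mem_Icc_of_mem_closedPinchedAnnulus hmem).2
      rw [h3, add_sub_cancel_right, div_self hm0.ne']
      exact max_eq_right (by linarith)

/-- The inner segments bulge out of the disc of radius `3`, hence a minimum. The lines carrying them
leave the disc again at greater height; the correction term, active only above the rays through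
`(±(𝐦 - 𝐤), 1)` in the upper half-plane and symmetrically below, makes the norm win there. -/
theorem innerGauge_eq_one_iff (p : ℝ²) : innerGauge p = 1 ↔
    (1 ≤ |p 1| ∧ ‖p‖ = 3) ∨ (|p 1| ≤ 1 ∧ |p 0| = 𝐦 - 𝐤 * |p 1|) := by
  obtain ⟨⟨hm, hm'⟩, hk, hk'⟩ := pinch_bounds
  have hsq : |p 0| ^ 2 + |p 1| ^ 2 = ‖p‖ ^ 2 := by rw [norm_sq_eq_coord, sq_abs, sq_abs]
  have h0 := abs_nonneg (p 0)
  have h1 := abs_nonneg (p 1)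
  have hab := pinchAbscissa_sub_sq
  have hn := norm_nonneg p
  have hm0 : 0 < 𝐦 := by linarith
  have ha0 : 0 < 𝐦 - 𝐤 := by linarith
  set s := |p 0| / (𝐦 - 𝐤) with hs
  have hs0 : 0 ≤ s := by positivity
  have hps : |p 0| = (𝐦 - 𝐤) * s := by rw [hs]; field_simp
  -- Write `(|p 0|, |p 1|) = s (𝐦 - 𝐤, 1) + (0, w)`: the vector `(𝐦 - 𝐤, 1)` has norm `3` and linear
  -- gauge one, so the norm is at most `3 s + w` and the linear gauge is `s + 𝐤 w / 𝐦`.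
  have hfar : 0 ≤ |p 1| - s →
      ‖p‖ / 3 + 𝐤 / 𝐦 * (|p 1| - s) ≤ (|p 0| + 𝐤 * |p 1|) / 𝐦 + (|p 1| - s) / 3 := fun hw => by
    have e1 : (|p 0| + 𝐤 * |p 1|) / 𝐦 = s + 𝐤 / 𝐦 * (|p 1| - s) := by
      rw [hps]; field_simp; ring
    have e2 : ‖p‖ ≤ 3 * s + (|p 1| - s) := by
      refine (abs_le_of_sq_le_sq' ?_ (by linarith)).2
      rw [← hsq, hps, mul_pow, hab]
      nlinarith [mul_nonneg hs0 hw]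
    linarith
  rw [innerGauge, ← hs]
  set B := (|p 0| + 𝐤 * |p 1|) / 𝐦 + max 0 (|p 1| - s) / 3 with hB
  constructor
  · intro h
    have hA1 : 3 ≤ ‖p‖ := by linarith [min_le_left (‖p‖ / 3) B]
    have hB1 : 1 ≤ B := h.symm.trans_le (min_le_right _ _)
    rcases min_choice (‖p‖ / 3) B with e | e <;> rw [h] at e
    · have hp : ‖p‖ = 3 := by linarith
      refine .inl ⟨not_lt.1 fun hlt => ?_, hp⟩
      rw [hp] at hsq
      have h3 : 𝐦 - 𝐤 < |p 0| := lt_of_pow_lt_pow_left₀ 2 h0 (by nlinarith)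
      have h4 : 1 ≤ s := by rw [hs, le_div_iff₀ ha0]; linarith
      rw [hB, max_eq_left (by linarith), zero_div, add_zero, le_div_iff₀ hm0] at hB1
      have h5 : (𝐦 - 𝐤 * |p 1|) ^ 2 ≤ |p 0| ^ 2 :=
        pow_le_pow_left₀ (by nlinarith) (by linarith) 2
      have hk2 : 𝐤 ^ 2 < 0.3 := by nlinarith
      have e3 : (𝐦 - 𝐤 * |p 1|) ^ 2 + |p 1| ^ 2 - 9 =
          (1 - |p 1|) * (5 / 2 - 𝐤 ^ 2 - (𝐤 ^ 2 + 1) * |p 1|) := by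
        linear_combination pinchAbscissa_sq_add_pinchSlope_sq -
          2 * |p 1| * pinchAbscissa_mul_pinchSlope
      have : 0 < (1 - |p 1|) * (5 / 2 - 𝐤 ^ 2 - (𝐤 ^ 2 + 1) * |p 1|) :=
        mul_pos (by linarith) (by nlinarith)
      linarith
    · have hw : |p 1| - s ≤ 0 := not_lt.1 fun hlt => by
        have h3 := hfar hlt.le
        rw [hB, max_eq_right hlt.le] at e
        have : 0 < 𝐤 / 𝐦 * (|p 1| - s) := mul_pos (div_pos (by linarith) hm0) hlt
        linarith
      rw [hB, max_eq_left hw, zero_div, add_zero, eq_comm, div_eq_one_iff_eq hm0.ne'] at e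
      refine .inr ⟨?_, by linarith⟩
      by_contra! hlt
      rw [hps] at e
      nlinarith
  · rintro (⟨h2, h3⟩ | ⟨h2, h3⟩)
    · rw [h3] at hsq
      have h4 : |p 0| ≤ 𝐦 - 𝐤 := (abs_le_of_sq_le_sq' (by nlinarith) (by linarith)).2
      have h5 : s ≤ 1 := by rw [hs, div_le_one ha0]; exact h4
      have h6 := hfar (by linarith)
      have : 0 ≤ 𝐤 / 𝐦 * (|p 1| - s) := mul_nonneg (div_nonneg (by linarith) hm0.le) (by linarith)
      rw [min_eq_left, h3]
      · norm_num
      · rw [hB, max_eq_right (by linarith)]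
        linarith
    · have hmem : p ∈ closedPinchedAnnulus := .inr ⟨h2, by
        rw [h3, abs_sub_comm, sub_sub_cancel, abs_of_nonneg (by nlinarith)]⟩
      have := (norm_mem_Icc_of_mem_closedPinchedAnnulus hmem).1
      have h5 : 1 ≤ s := by rw [hs, le_div_iff₀ ha0]; nlinarith
      have hB1 : B = 1 := by
        rw [hB, h3, max_eq_left (by linarith), sub_add_cancel, div_self hm0.ne']; norm_num
      rw [hB1]
      exact min_eq_right (by linarith)

theorem mem_pinchedCurve_iff_gauge (p : ℝ²) :
    p ∈ pinchedCurve ↔ outerGauge p = 1 ∨ innerGauge p = 1 := by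
  obtain ⟨-, hk, hk'⟩ := pinch_bounds
  have : |(|p 0| - 𝐦)| = 𝐤 * |p 1| ↔ |p 0| = 𝐦 + 𝐤 * |p 1| ∨ |p 0| = 𝐦 - 𝐤 * |p 1| := by
    rw [abs_eq (mul_nonneg (by linarith) (abs_nonneg _)), sub_eq_iff_eq_add', sub_eq_iff_eq_add',
      ← sub_eq_add_neg]
  rw [mem_pinchedCurve_iff, outerGauge_eq_one_iff, innerGauge_eq_one_iff, this]
  tauto

/-- With its inner counterpart: the circle `‖p‖ = 𝐦` separates the outer arcs from the inner ones,
with a gap linear in the height. This quantifies the transversality of the pinch. -/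
theorem add_le_norm_of_outerGauge_eq_one {p : ℝ²} (hp : outerGauge p = 1) :
    𝐦 + |p 1| / 10 ≤ ‖p‖ := by
  obtain ⟨⟨hm, hm'⟩, hk, hk'⟩ := pinch_bounds
  have h1 := abs_nonneg (p 1)
  rcases (outerGauge_eq_one_iff p).1 hp with ⟨-, h⟩ | ⟨-, h⟩
  · linarith [abs_coord_le_norm p 1]
  · nlinarith [abs_coord_le_norm p 0]

theorem norm_le_sub_of_innerGauge_eq_one {p : ℝ²} (hp : innerGauge p = 1) :
    ‖p‖ ≤ 𝐦 - |p 1| / 10 := by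
  obtain ⟨⟨hm, hm'⟩, hk, hk'⟩ := pinch_bounds
  have h1 := abs_nonneg (p 1)
  rcases (innerGauge_eq_one_iff p).1 hp with ⟨-, h⟩ | ⟨h2, h⟩
  · linarith [abs_coord_le_norm p 1]
  · refine (abs_le_of_sq_le_sq' ?_ (by linarith)).2
    rw [norm_sq_eq_coord, ← sq_abs (p 0), h, ← sq_abs (p 1)]
    have hk2 : 𝐤 ^ 2 < 0.3 := by nlinarith
    have : 0 ≤ |p 1| * (2 * (7 / 4 - 𝐦 / 10) - (𝐤 ^ 2 + 99 / 100) * |p 1|) :=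
      mul_nonneg h1 (by nlinarith)
    nlinarith [pinchAbscissa_mul_pinchSlope]

/-- The four arcs joining the two pinch points. -/
noncomputable def pinchArc : Fin 4 → Set ℝ² :=
  ![{p | 0 ≤ p 1 ∧ outerGauge p = 1}, {p | p 1 ≤ 0 ∧ outerGauge p = 1},
    {p | 0 ≤ p 1 ∧ innerGauge p = 1}, {p | p 1 ≤ 0 ∧ innerGauge p = 1}]

theorem isBilipschitzArc_pinchArc (i : Fin 4) : IsBilipschitzArc 544 3 (pinchArc i) := by
  fin_cases i
  · exact isPlaneGauge_outerGauge.isBilipschitzArc_upper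
  · exact isPlaneGauge_outerGauge.isBilipschitzArc_lower (outerGauge_coordFlip 1)
  · exact isPlaneGauge_innerGauge.isBilipschitzArc_upper
  · exact isPlaneGauge_innerGauge.isBilipschitzArc_lower (innerGauge_coordFlip 1)

theorem pinchedCurve_eq_iUnion : pinchedCurve = ⋃ i, pinchArc i := by
  ext p
  rw [mem_pinchedCurve_iff_gauge, mem_iUnion, Fin.exists_fin_succ, Fin.exists_fin_succ,
    Fin.exists_fin_succ, Fin.exists_fin_one]
  change _ ↔ (0 ≤ p 1 ∧ outerGauge p = 1) ∨ (p 1 ≤ 0 ∧ outerGauge p = 1) ∨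
    (0 ≤ p 1 ∧ innerGauge p = 1) ∨ (p 1 ≤ 0 ∧ innerGauge p = 1)
  have := le_total 0 (p 1)
  tauto

theorem pinchArc_subset (i : Fin 4) : pinchArc i ⊆ pinchedCurve := by
  rw [pinchedCurve_eq_iUnion]
  exact subset_iUnion _ i

theorem mem_pinchArc_of_abs_eq {P : ℝ²} (h0 : |P 0| = 𝐦) (h1 : P 1 = 0) (i : Fin 4) :
    P ∈ pinchArc i := by
  have ho : outerGauge P = 1 := (outerGauge_eq_one_iff P).2 (.inr (by simp [h0, h1]))
  have hi : innerGauge P = 1 := (innerGauge_eq_one_iff P).2 (.inr (by simp [h0, h1]))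
  fin_cases i
  · exact ⟨h1.ge, ho⟩
  · exact ⟨h1.le, ho⟩
  · exact ⟨h1.ge, hi⟩
  · exact ⟨h1.le, hi⟩

/-- The right pinch point. -/
noncomputable def pinchPoint : ℝ² := !₂[𝐦, 0]

@[simp] theorem pinchPoint_zero : pinchPoint 0 = 𝐦 := by simp [pinchPoint]

@[simp] theorem pinchPoint_one : pinchPoint 1 = 0 := by simp [pinchPoint]

theorem norm_pinchPoint_le : ‖pinchPoint‖ ≤ 𝐦 := by
  refine (norm_le_abs_add_abs _).trans ?_
  rw [pinchPoint_zero, pinchPoint_one, abs_zero, add_zero, abs_of_pos (by linarith [pinch_bounds.1.1])]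

theorem pinchPoint_mem_pinchArc (i : Fin 4) : pinchPoint ∈ pinchArc i :=
  mem_pinchArc_of_abs_eq (by simp [abs_of_pos (by linarith [pinch_bounds.1.1] : 0 < 𝐦)])
    (by simp) i

theorem coordFlip_pinchPoint_mem_pinchArc (i : Fin 4) : coordFlip 0 pinchPoint ∈ pinchArc i :=
  mem_pinchArc_of_abs_eq
    (by simp [abs_coordFlip, abs_of_pos (by linarith [pinch_bounds.1.1] : 0 < 𝐦)])
    (by simp [coordFlip_of_ne]) i

/-! ### Connectedness, Ahlfors–David regularity and Poincaré inequality of the curve. -/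

theorem isConnected_pinchedCurve : IsConnected pinchedCurve := by
  refine ⟨⟨pinchPoint, pinchArc_subset 0 (pinchPoint_mem_pinchArc 0)⟩, ?_⟩
  rw [pinchedCurve_eq_iUnion]
  exact isPreconnected_iUnion ⟨pinchPoint, mem_iInter.2 pinchPoint_mem_pinchArc⟩
    fun i => (isBilipschitzArc_pinchArc i).isPreconnected

theorem hausdorffMeasure_ball_inter_pinchedCurve_le (x : ℝ²) {r : ℝ} (hr : 0 < r) :
    -- Four arcs, each contributing `2 * 544 * 3`.
    μH[1] (ball x r ∩ pinchedCurve) ≤ ENNReal.ofReal (13056 * r) := by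
  rw [pinchedCurve_eq_iUnion, inter_iUnion]
  refine (measure_iUnion_fintype_le _ _).trans ?_
  refine (Finset.sum_le_sum fun i _ =>
    (isBilipschitzArc_pinchArc i).hausdorffMeasure_ball_inter_le x r).trans ?_
  rw [← ENNReal.ofReal_sum_of_nonneg (fun _ _ => by positivity)]
  refine ENNReal.ofReal_le_ofReal ?_
  simp
  linarith

theorem isADR_pinchedCurve : IsADR 1 pinchedCurve :=
  isADR_one_of_isPreconnected (frontier_pinchedAnnulus ▸ isClosed_frontier)
    isConnected_pinchedCurve.isPreconnected
    fun x _ _ hr => hausdorffMeasure_ball_inter_pinchedCurve_le x hr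

/-- On the same part in opposite half-planes, the heights add up to their difference. On different
parts, the radial gap applies and costs the factor `10`. -/
theorem exists_pinchArc_or_abs_add_abs_le {x y : ℝ²} (hx : x ∈ pinchedCurve)
    (hy : y ∈ pinchedCurve) :
    (∃ i, x ∈ pinchArc i ∧ y ∈ pinchArc i) ∨ |x 1| + |y 1| ≤ 10 * dist x y := by
  have hd : |x 1 - y 1| ≤ dist x y := by
    rw [dist_eq_norm]; exact abs_coord_le_norm (x - y) 1
  have hn : |‖x‖ - ‖y‖| ≤ dist x y := by rw [dist_eq_norm]; exact abs_norm_sub_norm_le x y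
  have hd0 : 0 ≤ dist x y := dist_nonneg
  have opp : ∀ {a b : ℝ}, 0 ≤ a → b ≤ 0 → |a| + |b| = |a - b| := fun {a b} ha hb => by
    rw [abs_of_nonneg ha, abs_of_nonpos hb, abs_of_nonneg (by linarith)]; ring
  rw [mem_pinchedCurve_iff_gauge] at hx hy
  rcases hx with hx | hx <;> rcases hy with hy | hy
  · rcases le_total 0 (x 1) with h | h <;> rcases le_total 0 (y 1) with h' | h'
    · exact .inl ⟨0, ⟨h, hx⟩, ⟨h', hy⟩⟩
    · right; linarith [opp h h']
    · right; linarith [opp h' h, abs_sub_comm (x 1) (y 1)]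
    · exact .inl ⟨1, ⟨h, hx⟩, ⟨h', hy⟩⟩
  · right
    linarith [add_le_norm_of_outerGauge_eq_one hx, norm_le_sub_of_innerGauge_eq_one hy,
      le_abs_self (‖x‖ - ‖y‖)]
  · right
    linarith [add_le_norm_of_outerGauge_eq_one hy, norm_le_sub_of_innerGauge_eq_one hx,
      neg_abs_le (‖x‖ - ‖y‖)]
  · rcases le_total 0 (x 1) with h | h <;> rcases le_total 0 (y 1) with h' | h'
    · exact .inl ⟨2, ⟨h, hx⟩, ⟨h', hy⟩⟩
    · right; linarith [opp h h']
    · right; linarith [opp h' h, abs_sub_comm (x 1) (y 1)]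
    · exact .inl ⟨3, ⟨h, hx⟩, ⟨h', hy⟩⟩

theorem dist_pinchPoint_le {p : ℝ²} (hp : p ∈ pinchedCurve) (h0 : 0 ≤ p 0) :
    dist p pinchPoint ≤ 8 * |p 1| := by
  obtain ⟨⟨hm, hm'⟩, hk, hk'⟩ := pinch_bounds
  rw [dist_eq_norm]
  have hp' := hp
  rw [mem_pinchedCurve_iff, abs_of_nonneg h0] at hp'
  rcases hp' with ⟨h, -⟩ | ⟨-, h⟩
  · linarith [norm_sub_le p pinchPoint, norm_pinchPoint_le, norm_le_of_mem_pinchedCurve hp]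
  · refine (norm_le_abs_add_abs _).trans ?_
    rw [PiLp.sub_apply, PiLp.sub_apply, pinchPoint_zero, pinchPoint_one, h, sub_zero]
    nlinarith [abs_nonneg (p 1)]

theorem coordFlip_coordFlip (i : Fin 2) (p : ℝ²) : coordFlip i (coordFlip i p) = p := by
  ext j
  rcases eq_or_ne j i with rfl | h
  · rw [coordFlip_same, coordFlip_same, neg_neg]
  · rw [coordFlip_of_ne h, coordFlip_of_ne h]

theorem dist_coordFlip_pinchPoint_le {p : ℝ²} (hp : p ∈ pinchedCurve) (h0 : p 0 ≤ 0) :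
    dist p (coordFlip 0 pinchPoint) ≤ 8 * |p 1| := by
  have h := dist_pinchPoint_le (coordFlip_mem_pinchedCurve.2 hp : coordFlip 0 p ∈ _)
    (by rw [coordFlip_same]; linarith)
  rwa [abs_coordFlip, ← (coordFlip 0).dist_map, coordFlip_coordFlip] at h

/-- Two points of different arcs are joined through a pinch point at comparable distance. -/
theorem exists_pinchPoint_between {x y : ℝ²} (hx : x ∈ pinchedCurve) (hy : y ∈ pinchedCurve)
    (h : |x 1| + |y 1| ≤ 10 * dist x y) :
    ∃ P, (∀ i, P ∈ pinchArc i) ∧ dist x P ≤ 80 * dist x y ∧ dist P y ≤ 80 * dist x y := by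
  obtain ⟨⟨hm, hm'⟩, hk, hk'⟩ := pinch_bounds
  have hx1 := abs_nonneg (x 1)
  have hy1 := abs_nonneg (y 1)
  -- Points on opposite sides of the vertical axis: `|x 0| ≤ d` and `|x 1| ≤ 10 d` with `‖x‖ ≥ 3`
  -- force `d ≥ 3 / 11`, so `80 d` exceeds every distance involved and either pinch point would do.
  have hfar : |x 0| ≤ dist x y →
      ∃ P, (∀ i, P ∈ pinchArc i) ∧ dist x P ≤ 80 * dist x y ∧ dist P y ≤ 80 * dist x y := by
    intro h0
    have hx3 : 3 ≤ ‖x‖ := by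
      rw [← closedPinchedAnnulus_diff] at hx
      exact (norm_mem_Icc_of_mem_closedPinchedAnnulus hx.1).1
    have := norm_le_abs_add_abs x
    have hxP := norm_sub_le x pinchPoint
    have hyP := norm_sub_le pinchPoint y
    have := norm_le_of_mem_pinchedCurve hx
    have := norm_le_of_mem_pinchedCurve hy
    have := norm_pinchPoint_le
    refine ⟨pinchPoint, pinchPoint_mem_pinchArc, ?_, ?_⟩ <;> rw [dist_eq_norm] <;> linarith
  have hd : |x 0 - y 0| ≤ dist x y := by
    rw [dist_eq_norm]; exact abs_coord_le_norm (x - y) 0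
  rw [abs_le] at hd
  rcases le_total 0 (x 0) with h0 | h0 <;> rcases le_total 0 (y 0) with h0' | h0'
  · refine ⟨pinchPoint, pinchPoint_mem_pinchArc, ?_, ?_⟩
    · linarith [dist_pinchPoint_le hx h0]
    · rw [dist_comm]; linarith [dist_pinchPoint_le hy h0']
  · exact hfar (by rw [abs_of_nonneg h0]; linarith)
  · exact hfar (by rw [abs_of_nonpos h0]; linarith)
  · refine ⟨coordFlip 0 pinchPoint, coordFlip_pinchPoint_mem_pinchArc, ?_, ?_⟩
    · linarith [dist_coordFlip_pinchPoint_le hx h0]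
    · rw [dist_comm]; linarith [dist_coordFlip_pinchPoint_le hy h0']

theorem supportsWeakPoincare_pinchedCurve :
    SupportsWeakPoincare (μH[1] : Measure pinchedCurve) 1 := by
  refine supportsWeakPoincare_hausdorffMeasure_one_of_chains (D := 13056) (K := 544 * 3)
    (K' := 80) (by norm_num) (fun x r hr => ?_) fun x y => ?_
  · rw [← isometry_subtype_coe.hausdorffMeasure_image (.inl zero_le_one)]
    refine (measure_mono ?_).trans (hausdorffMeasure_ball_inter_pinchedCurve_le (x : ℝ²) hr)
    rintro _ ⟨z, hz, rfl⟩
    exact ⟨hz, z.2⟩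
  · rcases exists_pinchArc_or_abs_add_abs_le x.2 y.2 with ⟨i, hx, hy⟩ | h
    · have hA := isBilipschitzArc_pinchArc i
      have hd : 0 ≤ dist x y := dist_nonneg
      -- On a common arc the intermediate point is `y` itself.
      refine ⟨y, hA.exists_isChordArcPath (pinchArc_subset i) hx hy,
        hA.exists_isChordArcPath (pinchArc_subset i) hy hy, ?_, ?_⟩
      · push_cast; linarith
      · rw [dist_self]; positivity
    · obtain ⟨P, hP, h1, h2⟩ := exists_pinchPoint_between x.2 y.2 h
      obtain ⟨i, hi⟩ := mem_iUnion.1 (pinchedCurve_eq_iUnion.subset x.2)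
      obtain ⟨j, hj⟩ := mem_iUnion.1 (pinchedCurve_eq_iUnion.subset y.2)
      exact ⟨⟨P, pinchArc_subset i (hP i)⟩,
        (isBilipschitzArc_pinchArc i).exists_isChordArcPath (pinchArc_subset i) hi (hP i),
        (isBilipschitzArc_pinchArc j).exists_isChordArcPath (pinchArc_subset j) (hP j) hj,
        h1, h2⟩

theorem boundarySupportsWeakPoincare_pinchedAnnulus :
    BoundarySupportsWeakPoincare 1 pinchedAnnulus 1 := by
  rw [BoundarySupportsWeakPoincare, surfaceMeasure_one_eq, frontier_pinchedAnnulus]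
  exact supportsWeakPoincare_pinchedCurve

theorem mainTheorem9 :
    IsOpen pinchedAnnulus ∧ Bornology.IsBounded pinchedAnnulus ∧
    frontier pinchedAnnulus = pinchedCurve ∧
    ¬ IsConnected pinchedAnnulus ∧
    IsConnected (frontier pinchedAnnulus) ∧
    IsADR 1 (frontier pinchedAnnulus) ∧
    TwoSided Corkscrew pinchedAnnulus ∧
    BoundarySupportsWeakPoincare 1 pinchedAnnulus 1 ∧
    ¬ IsCAD 1 pinchedAnnulus ∧
    ¬ (∀ U : Set (EuclideanSpace ℝ (Fin 2)), IsOpen U → (frontier U).Nonempty →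
        IsADR 1 (frontier U) → TwoSided Corkscrew U → BoundarySupportsWeakPoincare 1 U 1 →
        TwoSided (IsCAD 1) U) := by
  have hconn : IsConnected (frontier pinchedAnnulus) :=
    frontier_pinchedAnnulus ▸ isConnected_pinchedCurve
  have hADR : IsADR 1 (frontier pinchedAnnulus) := frontier_pinchedAnnulus ▸ isADR_pinchedCurve
  exact ⟨isOpen_pinchedAnnulus, isBounded_pinchedAnnulus, frontier_pinchedAnnulus,
    fun h => not_isPreconnected_pinchedAnnulus h.isPreconnected, hconn, hADR,
    twoSided_corkscrew_pinchedAnnulus, boundarySupportsWeakPoincare_pinchedAnnulus,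
    not_isCAD_pinchedAnnulus, fun h => not_isCAD_pinchedAnnulus
      (h _ isOpen_pinchedAnnulus hconn.nonempty hADR twoSided_corkscrew_pinchedAnnulus
        boundarySupportsWeakPoincare_pinchedAnnulus).1⟩
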